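/- Let $p$ be a prime and let $(A,\mathfrak m)\to(R,\mathfrak n)$ be a flat local homomorphism (automatically injective) of Noetherian normal local domains of characteristic $p$ such that $R/\mathfrak mR$ is a regular local ring; write $f:\operatorname{Spec}R\to\operatorname{Spec}A$ for the induced map. Let $D=\sum_P n_P P$ be an effective Weil divisor on $\operatorname{Spec}A$, where $P$ ranges over the height one primes of $A$, and let $e>0$ be an integer. Let $A(D)=\{g\in\operatorname{Frac}(A)\mid g=0\text{ or }\operatorname{div}(g)+D\ge 0\}$, let $F^e_*A(D)$ be the abelian group $A(D)$ on which $a\in A$ acts as multiplication by $a^{p^e}$, and let $$I_e(A,D)=\bigl\langle a\in A \;\bigm|\; A\to F^e_*A(D),\ 1\mapsto F^e_*a,\ \text{is not a pure map of $A$-modules}\bigr\rangle ,$$ where a map $M\to N$ of $A$-modules is pure if $M\otimes_AQ\to N\otimes_AQ$ is injective for every $A$-module $Q$. Let $f^*D$ be the flat pullback of $D$, that is, the effective Weil divisor on $\operatorname{Spec}R$ whose coefficient at a height one prime $\mathfrak q$ of $R$ is $n_P\cdot\ell_{R_{\mathfrak q}}(R_{\mathfrak q}/PR_{\mathfrak q})$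 if $P=\mathfrak q\cap A$ has height one, and $0$ otherwise; define $I_e(R,f^*D)$ in the same way over $R$. Then $A/I_e(A,D)$ has finite length and $$\ell_R\bigl(R/I_e(R,f^*D)\bigr)=p^{e(\dim R-\dim A)}\cdot\ell_A\bigl(A/I_e(A,D)\bigr),$$ where $\dim R-\dim A$ is a non-negative integer. More precisely, if $\delta=\dim R/\mathfrak mR$ and $x_1,\dots,x_\delta\in R$ are elements whose images in $R/\mathfrak mR$ form a regular system of parameters (generate its maximal ideal), then $$I_e(R,f^*D)=I_e(A,D)R+\bigl(x_1^{p^e},\dots,x_\delta^{p^e}\bigr).$$ -/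

import Mathlib

open IsLocalRing

noncomputable section

universe u v

/-- An `A`-linear map `f : M → N` is pure if `f ⊗ Q : M ⊗ Q → N ⊗ Q` is injective for every
`A`-module `Q`. (Every module is the filtered union of its finitely generated submodules, so it is
enough to let `Q` range over the modules in the universe of `A`.) -/
def IsPureMap {A : Type u} [CommRing A] {M N : Type*} [AddCommGroup M] [Module A M]
    [AddCommGroup N] [Module A N] (f : M →ₗ[A] N) : Prop :=
  ∀ (Q : Type u) [AddCommGroup Q] [Module A Q], Function.Injective (f.rTensor Q)

/-- The Frobenius pushforward `F^e_* M` of an `A`-module `M`, also written `M^{1/p^e}`: the abelian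
group `M` on which `a` acts as `a ^ p ^ e`. -/
def FrobeniusPushforward (A : Type*) (_p _e : ℕ) (M : Type*) [CommRing A] [AddCommGroup M]
    [Module A M] : Type _ := M

namespace FrobeniusPushforward

variable (A : Type*) (p e : ℕ) (M : Type*) [CommRing A] [AddCommGroup M] [Module A M]

instance : AddCommGroup (FrobeniusPushforward A p e M) := inferInstanceAs (AddCommGroup M)

instance [ExpChar A p] : Module A (FrobeniusPushforward A p e M) :=
  Module.compHom M (iterateFrobenius A p e)

/-- The element `F^e_* m` of `F^e_* M`. -/
def of (m : M) : FrobeniusPushforward A p e M := m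

theorem smul_of [ExpChar A p] (a : A) (m : M) :
    a • of A p e M m = of A p e M (a ^ p ^ e • m) := rfl

end FrobeniusPushforward

/-- The height one primes of `A`, that is, the prime divisors on `Spec A`. -/
abbrev HeightOnePrime (A : Type*) [CommRing A] : Type _ :=
  {P : PrimeSpectrum A // P.asIdeal.height = 1}

/-- Weil divisors on `Spec A`; a divisor `D` is effective if `0 ≤ D`. -/
abbrev WeilDivisor (A : Type*) [CommRing A] : Type _ := HeightOnePrime A →₀ ℤ

namespace HeightOnePrime

/-- The local ring `A_P`. -/
abbrev localRing {A : Type*} [CommRing A] (P : HeightOnePrime A) : Type _ :=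
  Localization.AtPrime P.1.asIdeal

instance {A : Type*} [CommRing A] [IsDomain A] [IsNoetherianRing A] [IsIntegrallyClosed A]
    (P : HeightOnePrime A) : IsDiscreteValuationRing P.localRing := by
  have hic : IsIntegrallyClosed P.localRing :=
    isIntegrallyClosed_of_isLocalization P.localRing P.1.asIdeal.primeCompl
      P.1.asIdeal.primeCompl_le_nonZeroDivisors
  have hdim : ringKrullDim P.localRing = 1 := by
    rw [IsLocalization.AtPrime.ringKrullDim_eq_height P.1.asIdeal P.localRing, P.2]; rfl
  have hht : (maximalIdeal P.localRing).height = 1 := by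
    have h := IsLocalRing.maximalIdeal_height_eq_ringKrullDim (R := P.localRing)
    rw [hdim] at h
    exact_mod_cast h
  have hfield : ¬ IsField P.localRing := fun h =>
    Ideal.ne_bot_of_height_eq_one hht ((isField_iff_maximalIdeal_eq).1 h)
  have : (maximalIdeal P.localRing).FiniteHeight := by
    simp [Ideal.finiteHeight_iff, hht]
  have huniq : ∃! I : Ideal P.localRing, I ≠ ⊥ ∧ I.IsPrime := by
    refine ⟨maximalIdeal P.localRing, ⟨Ideal.ne_bot_of_height_eq_one hht, inferInstance⟩, ?_⟩
    rintro I ⟨hI, hI'⟩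
    refine Ideal.eq_of_le_of_height_le _ (le_maximalIdeal hI'.ne_top) ?_
    rw [hht, Order.one_le_iff_ne_zero]
    exact fun h => hI (Ideal.height_eq_zero_iff_eq_bot.1 h)
  have h : IsDiscreteValuationRing P.localRing ↔
      IsIntegrallyClosed P.localRing ∧ ∃! I : Ideal P.localRing, I ≠ ⊥ ∧ I.IsPrime :=
    (IsDiscreteValuationRing.TFAE P.localRing hfield).out 0 3
  exact h.2 ⟨hic, huniq⟩

/-- The discrete valuation of the fraction field of `A` attached to the height one prime `P`,
written multiplicatively: if `f ≠ 0` vanishes to order `n` along `P`, then its value is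
`exp (-n)`. -/
def valuation {A : Type*} [CommRing A] [IsDomain A] [IsNoetherianRing A] [IsIntegrallyClosed A]
    (P : HeightOnePrime A) : Valuation (FractionRing A) (WithZero (Multiplicative ℤ)) :=
  (IsDiscreteValuationRing.maximalIdeal P.localRing).valuation (FractionRing A)

theorem valuation_algebraMap_le_one {A : Type*} [CommRing A] [IsDomain A] [IsNoetherianRing A]
    [IsIntegrallyClosed A] (P : HeightOnePrime A) (a : A) :
    P.valuation (algebraMap A (FractionRing A) a) ≤ 1 := by
  rw [IsScalarTower.algebraMap_apply A P.localRing (FractionRing A)]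
  exact IsDedekindDomain.HeightOneSpectrum.valuation_le_one _ _

end HeightOnePrime

namespace WeilDivisor

section Module

variable {A : Type*} [CommRing A] [IsDomain A] [IsNoetherianRing A] [IsIntegrallyClosed A]

/-- The module `A(D)` of those `f` in the fraction field with `f = 0` or `div f + D ≥ 0`. -/
def sections (D : WeilDivisor A) : Submodule A (FractionRing A) where
  carrier := {f | ∀ P : HeightOnePrime A, P.valuation f ≤ WithZero.exp (D P)}
  zero_mem' P := by simp
  add_mem' hf hg P := Valuation.map_add_le _ (hf P) (hg P)
  smul_mem' a f hf P := by
    rw [Algebra.smul_def, map_mul]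
    exact (mul_le_of_le_one_left' (P.valuation_algebraMap_le_one a)).trans (hf P)

theorem algebraMap_mem_sections {D : WeilDivisor A} (hD : 0 ≤ D) (a : A) :
    algebraMap A (FractionRing A) a ∈ D.sections := fun P =>
  (P.valuation_algebraMap_le_one a).trans <| by
    rw [← WithZero.exp_zero, WithZero.exp_le_exp]
    exact hD P

/-- For an effective divisor `D`, the `A`-linear map `A → F^e_* A(D)` with `1 ↦ F^e_* a`. -/
def frobeniusMap (D : WeilDivisor A) (p e : ℕ) [ExpChar A p] (hD : 0 ≤ D) (a : A) :
    A →ₗ[A] FrobeniusPushforward A p e D.sections :=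
  LinearMap.toSpanSingleton A _
    (FrobeniusPushforward.of A p e D.sections
      ⟨algebraMap A (FractionRing A) a, algebraMap_mem_sections hD a⟩)

/-- The `e`-th Frobenius degeneracy ideal `I_e(A, D)` along the effective divisor `D`. -/
def degeneracyIdeal (D : WeilDivisor A) (p e : ℕ) [ExpChar A p] (hD : 0 ≤ D) : Ideal A :=
  Ideal.span {a : A | ¬ IsPureMap (D.frobeniusMap p e hD a)}

end Module

section Pullback

variable {A : Type u} (R : Type v) [CommRing A] [CommRing R] [Algebra A R]

open Classical in
/-- The coefficient at `Q` of the flat pullback of `D` to `Spec R`: if `P = Q ∩ A` has height one,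
it is the coefficient of `D` at `P` times the length of the local ring `R_Q / P R_Q` at `Q` of the
preimage of the prime divisor `P`; otherwise `Q` lies over no prime divisor and it is zero. -/
def pullbackCoeff (D : WeilDivisor A) (Q : HeightOnePrime R) : ℤ :=
  if h : (Q.1.asIdeal.under A).height = 1 then
    D ⟨⟨Q.1.asIdeal.under A, inferInstance⟩, h⟩ *
      (Module.length Q.localRing
        (Q.localRing ⧸ (Q.1.asIdeal.under A).map (algebraMap A Q.localRing))).toNat
  else 0

theorem finite_support_pullbackCoeff [IsDomain A] [IsDomain R] [IsNoetherianRing R]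
    [Module.Flat A R] (D : WeilDivisor A) : (Function.support (D.pullbackCoeff R)).Finite := by
  have hinj : Function.Injective (algebraMap A R) := FaithfulSMul.algebraMap_injective A R
  have hfin : (⋃ P ∈ D.support,
      (P.1.asIdeal.map (algebraMap A R)).minimalPrimes).Finite :=
    D.support.finite_toSet.biUnion fun P _ =>
      Ideal.finite_minimalPrimes_of_isNoetherianRing R _
  refine Set.Finite.of_finite_image (f := fun Q => Q.1.asIdeal) (hfin.subset ?_) ?_
  · rintro _ ⟨Q, hQ, rfl⟩
    rw [Function.mem_support, pullbackCoeff] at hQ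
    split_ifs at hQ with h
    · refine Set.mem_biUnion (x := ⟨⟨Q.1.asIdeal.under A, inferInstance⟩, h⟩)
        (Finsupp.mem_support_iff.2 (left_ne_zero_of_mul hQ)) ?_
      have : Q.1.asIdeal.FiniteHeight := by simp [Ideal.finiteHeight_iff, Q.2]
      refine Ideal.mem_minimalPrimes_of_height_le Ideal.map_comap_le ?_
      rw [Q.2, Order.one_le_iff_ne_zero, Ne, Ideal.height_eq_zero_iff_eq_bot,
        Ideal.map_eq_bot_iff_of_injective hinj]
      exact Ideal.ne_bot_of_height_eq_one h
    · exact absurd rfl hQ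
  · exact fun Q _ Q' _ h => Subtype.ext (PrimeSpectrum.ext h)

/-- The pullback `f^* D` of a Weil divisor along a flat morphism `f : Spec R → Spec A`. -/
def pullback [IsDomain A] [IsDomain R] [IsNoetherianRing R] [Module.Flat A R]
    (D : WeilDivisor A) : WeilDivisor R :=
  Finsupp.ofSupportFinite (D.pullbackCoeff R) (D.finite_support_pullbackCoeff R)

theorem pullback_nonneg [IsDomain A] [IsDomain R] [IsNoetherianRing R] [Module.Flat A R]
    {D : WeilDivisor A} (hD : 0 ≤ D) : 0 ≤ D.pullback R := fun Q => by
  change 0 ≤ D.pullbackCoeff R Q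
  unfold pullbackCoeff
  split_ifs with h
  · exact mul_nonneg (hD _) (Int.natCast_nonneg _)
  · exact le_rfl

end Pullback

end WeilDivisor

end

/-!
Over a Noetherian local ring, the impurity of `1 ↦ F^e_* a` is detected by modules `Q` of finite
length with one-dimensional socle, spanned by `u` say: it means that `F^e_* a ⊗ u = 0`. By
Noetherianity a single such `Q` computes `I_e(A, D)`, as the annihilator of `F^e_* 1 ⊗ u`.

By the local criterion of flatness the `x_i` are regular on `R`, and `R` is flat over `A` modulo
every power `J_t` of the parameters, where `J_t = (x_1 ^ t, …, x_δ ^ t)`. As the closed fibre is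
regular, the socle of its quotient by `J_t` is spanned by the power `(x_1 ⋯ x_δ) ^ (t - 1)`, so
flatness makes `(x_1 ⋯ x_δ) ^ (t - 1) ⊗ u` a socle generator of `R ⧸ J_t ⊗ Q`. Since
`R(f^* D) = R ⊗ A(D)`, testing with these modules identifies `I_e(R, f^* D)` with the union over `t`
of the colon ideals of `I_e(A, D) R + J_{t p^e}` by `(x_1 ⋯ x_δ) ^ ((t - 1) p^e)`, and each of them
is `I_e(A, D) R + J_{p^e}`. The length formula then follows by flatness of `R ⧸ J_{p^e}` over `A`.
-/

open TensorProduct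

noncomputable section

universe w₁ w₂

section FiniteLength

variable {R : Type*} [CommRing R] [IsLocalRing R] {M : Type*} [AddCommGroup M] [Module R M]

theorem exists_pow_maximalIdeal_le_annihilator (h : IsFiniteLength R M) :
    ∃ j : ℕ, maximalIdeal R ^ j ≤ Module.annihilator R M := by
  induction h with
  | of_subsingleton =>
    exact ⟨0, le_top.trans_eq (Module.annihilator_eq_top_iff.2 inferInstance).symm⟩
  | @of_simple_quotient M _ _ N _ _ ih =>
    obtain ⟨j, hj⟩ := ih
    have hN : maximalIdeal R ≤ Module.annihilator R (M ⧸ N) :=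
      (eq_maximalIdeal (IsSimpleModule.annihilator_isMaximal (M := M ⧸ N))).ge
    refine ⟨j + 1, ?_⟩
    rw [pow_succ, Ideal.mul_le]
    intro a ha b hb
    rw [Module.mem_annihilator]
    intro z
    have hbz : b • z ∈ N := (Submodule.Quotient.mk_eq_zero N).1
      (Module.mem_annihilator.1 (hN hb) (N.mkQ z))
    rw [mul_smul]
    exact congrArg Subtype.val (Module.mem_annihilator.1 (hj ha) ⟨b • z, hbz⟩)

theorem isFiniteLength_of_pow_maximalIdeal_le_annihilator [IsNoetherianRing R] [Module.Finite R M]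
    {j : ℕ} (hj : maximalIdeal R ^ j ≤ Module.annihilator R M) : IsFiniteLength R M := by
  rcases subsingleton_or_nontrivial (R ⧸ maximalIdeal R ^ j) with hs | _
  · rw [Ideal.Quotient.subsingleton_iff.1 hs, top_le_iff, Module.annihilator_eq_top_iff] at hj
    exact .of_subsingleton
  have ht : Module.IsTorsionBySet R M (maximalIdeal R ^ j : Ideal R) :=
    fun z a => Module.mem_annihilator.1 (hj a.2) z
  let _ := ht.module
  have : IsScalarTower R (R ⧸ maximalIdeal R ^ j) M := ht.isScalarTower
  have : Module.Finite (R ⧸ maximalIdeal R ^ j) M := .of_restrictScalars_finite R _ _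
  have : IsLocalRing (R ⧸ maximalIdeal R ^ j) :=
    .of_surjective' _ (Ideal.Quotient.mk_surjective (I := maximalIdeal R ^ j))
  have hnil : IsNilpotent (maximalIdeal (R ⧸ maximalIdeal R ^ j)) := by
    refine ⟨j, ?_⟩
    rw [← map_maximalIdeal_of_surjective _ Ideal.Quotient.mk_surjective, ← Ideal.map_pow,
      Ideal.map_quotient_self, Ideal.zero_eq_bot]
  have := (isArtinianRing_iff_isNilpotent_maximalIdeal _).2 hnil
  rw [← Module.length_ne_top_iff,
    Module.length_eq_of_surjective (R := R ⧸ maximalIdeal R ^ j) Ideal.Quotient.mk_surjective]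
  exact Module.length_ne_top

end FiniteLength

/-- `u` lies in every nonzero submodule of `Q`. For a module of finite length over a local ring
this says that `u` generates the socle and that the socle is simple. -/
def IsSocleGenerator (R : Type*) {Q : Type*} [CommRing R] [AddCommGroup Q] [Module R Q]
    (u : Q) : Prop :=
  u ≠ 0 ∧ ∀ z : Q, z ≠ 0 → ∃ r : R, r • z = u

namespace IsSocleGenerator

section Basic

variable {R : Type*} [CommRing R] {Q Q' : Type*} [AddCommGroup Q] [Module R Q]
  [AddCommGroup Q'] [Module R Q'] {u : Q}

theorem mkQ_iff {K : Submodule R Q} :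
    IsSocleGenerator R (K.mkQ u) ↔ u ∉ K ∧ ∀ z ∉ K, ∃ r : R, r • z - u ∈ K := by
  rw [IsSocleGenerator, Ne, Submodule.mkQ_apply, Submodule.Quotient.mk_eq_zero]
  refine and_congr_right fun _ => ⟨fun h z hz => ?_, fun h z hz => ?_⟩
  · obtain ⟨r, hr⟩ := h (K.mkQ z) (by simpa using hz)
    exact ⟨r, (Submodule.Quotient.eq K).1 hr⟩
  · obtain ⟨z, rfl⟩ := K.mkQ_surjective z
    obtain ⟨r, hr⟩ := h z (by simpa using hz)
    exact ⟨r, (Submodule.Quotient.eq K).2 hr⟩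

theorem map_equiv (h : IsSocleGenerator R u) (e : Q ≃ₗ[R] Q') : IsSocleGenerator R (e u) := by
  refine ⟨by simpa using h.1, fun z hz => ?_⟩
  obtain ⟨r, hr⟩ := h.2 (e.symm z) (by simpa using hz)
  exact ⟨r, by rw [← hr]; simp⟩

theorem injective_of_map_ne_zero (h : IsSocleGenerator R u) (f : Q →ₗ[R] Q') (hf : f u ≠ 0) :
    Function.Injective f := by
  rw [injective_iff_map_eq_zero]
  intro z hz
  by_contra hne
  obtain ⟨r, hr⟩ := h.2 z hne
  exact hf (by rw [← hr, map_smul, hz, smul_zero])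

variable [IsLocalRing R]

theorem smul_eq_zero (h : IsSocleGenerator R u) {a : R} (ha : a ∈ maximalIdeal R) :
    a • u = 0 := by
  by_contra hne
  obtain ⟨r, hr⟩ := h.2 _ hne
  have hunit : IsUnit (1 - r * a) := by
    by_contra hnu
    exact (maximalIdeal R).ne_top_iff_one.1 (maximalIdeal.isMaximal R).ne_top
      (by simpa using add_mem ((mem_maximalIdeal _).2 hnu) (Ideal.mul_mem_left _ r ha))
  refine h.1 (hunit.smul_eq_zero.1 ?_)
  rw [sub_smul, one_smul, mul_smul, hr, sub_self]

theorem mem_span_of_smul_eq_zero (h : IsSocleGenerator R u) {z : Q}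
    (hz : ∀ a ∈ maximalIdeal R, a • z = 0) : z ∈ Submodule.span R {u} := by
  by_cases hz0 : z = 0
  · simp [hz0]
  obtain ⟨r, hr⟩ := h.2 z hz0
  have hunit : IsUnit r := by
    by_contra hnu
    exact h.1 (by rw [← hr, hz r ((mem_maximalIdeal _).2 hnu)])
  obtain ⟨s, hs⟩ := hunit.exists_left_inv
  exact Submodule.mem_span_singleton.2 ⟨s, by rw [← hr, smul_smul, hs, one_smul]⟩

theorem torsionOf_eq (h : IsSocleGenerator R u) : Ideal.torsionOf R Q u = maximalIdeal R := by
  refine le_antisymm (le_maximalIdeal fun htop => h.1 ?_) fun a ha =>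
    (Ideal.mem_torsionOf_iff _ _).2 (h.smul_eq_zero ha)
  have : (1 : R) ∈ Ideal.torsionOf R Q u := htop ▸ Submodule.mem_top
  simpa using this

end Basic

section Exists

variable {R : Type*} [CommRing R]

theorem exists_mkQ {Q : Type*} [AddCommGroup Q] [Module R Q] [IsNoetherian R Q]
    (L : Submodule R Q) {x : Q} (hx : x ∉ L) :
    ∃ K : Submodule R Q, L ≤ K ∧ IsSocleGenerator R (K.mkQ x) := by
  obtain ⟨K, ⟨hLK, hxK⟩, hmax⟩ := set_has_maximal_iff_noetherian.2 ‹IsNoetherian R Q›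
    {K : Submodule R Q | L ≤ K ∧ x ∉ K} ⟨L, le_rfl, hx⟩
  refine ⟨K, hLK, mkQ_iff.2 ⟨hxK, fun z hz => ?_⟩⟩
  have hlt : K < K ⊔ Submodule.span R {z} :=
    left_lt_sup.2 fun hle => hz (hle (Submodule.mem_span_singleton_self z))
  have hmem : x ∈ K ⊔ Submodule.span R {z} := by
    by_contra hne
    exact hmax _ ⟨hLK.trans le_sup_left, hne⟩ hlt
  obtain ⟨k, hk, y, hy, rfl⟩ := Submodule.mem_sup.1 hmem
  obtain ⟨r, rfl⟩ := Submodule.mem_span_singleton.1 hy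
  exact ⟨r, by simpa using hk⟩

/- Glue the two modules along their socles, then divide by a submodule that is maximal among
those avoiding the common socle. -/
theorem exists_amalgam [IsLocalRing R] {Q₁ : Type w₁} {Q₂ : Type w₂}
    [AddCommGroup Q₁] [Module R Q₁] [AddCommGroup Q₂] [Module R Q₂]
    (hQ₁ : IsFiniteLength R Q₁) (hQ₂ : IsFiniteLength R Q₂) {u₁ : Q₁} {u₂ : Q₂}
    (h₁ : IsSocleGenerator R u₁) (h₂ : IsSocleGenerator R u₂) :
    ∃ (Q : Type (max w₁ w₂)) (_ : AddCommGroup Q) (_ : Module R Q)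
      (i₁ : Q₁ →ₗ[R] Q) (i₂ : Q₂ →ₗ[R] Q), IsFiniteLength R Q ∧ i₁ u₁ = i₂ u₂ ∧
      IsSocleGenerator R (i₁ u₁) ∧
      Module.annihilator R Q₁ ⊓ Module.annihilator R Q₂ ≤ Module.annihilator R Q := by
  obtain ⟨_, _⟩ := isFiniteLength_iff_isNoetherian_isArtinian.1 hQ₁
  obtain ⟨_, _⟩ := isFiniteLength_iff_isNoetherian_isArtinian.1 hQ₂
  have hx : (u₁, (0 : Q₂)) ∉ Submodule.span R {(u₁, -u₂)} := by
    intro hmem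
    obtain ⟨r, hr⟩ := Submodule.mem_span_singleton.1 hmem
    rw [Prod.smul_mk, Prod.mk.injEq, smul_neg, neg_eq_zero] at hr
    have hrm : r ∈ maximalIdeal R := by
      rw [← h₂.torsionOf_eq]; exact (Ideal.mem_torsionOf_iff _ _).2 hr.2
    exact h₁.1 (by rw [← hr.1, h₁.smul_eq_zero hrm])
  obtain ⟨K, hLK, hK⟩ := exists_mkQ _ hx
  have hmem : (u₁, -u₂) ∈ K := hLK (Submodule.mem_span_singleton_self _)
  refine ⟨(Q₁ × Q₂) ⧸ K, inferInstance, inferInstance, K.mkQ ∘ₗ LinearMap.inl R Q₁ Q₂,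
    K.mkQ ∘ₗ LinearMap.inr R Q₁ Q₂,
    isFiniteLength_iff_isNoetherian_isArtinian.2 ⟨inferInstance, inferInstance⟩,
    (Submodule.Quotient.eq K).2 (by simpa using hmem), hK, ?_⟩
  rintro a ⟨ha₁, ha₂⟩
  rw [Module.mem_annihilator]
  intro z
  obtain ⟨⟨z₁, z₂⟩, rfl⟩ := K.mkQ_surjective z
  rw [← map_smul, Prod.smul_mk, Module.mem_annihilator.1 ha₁, Module.mem_annihilator.1 ha₂]
  exact map_zero _

end Exists

section Length

variable {R : Type*} [CommRing R] [IsLocalRing R] {Q : Type*} [AddCommGroup Q] [Module R Q] {u : Q}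

theorem length_span_le (h : IsSocleGenerator R u) :
    Module.length R (Submodule.span R {u}) ≤ 1 := by
  have e := Ideal.quotTorsionOfEquivSpanSingleton R Q u
  rw [h.torsionOf_eq] at e
  have := isSimpleModule_iff_quot_maximal.2 ⟨_, maximalIdeal.isMaximal R, ⟨.refl R _⟩⟩
  rw [← e.length_eq, Module.length_eq_one]

theorem length_hom_simple_le (h : IsSocleGenerator R u) (S : Type*) [AddCommGroup S] [Module R S]
    [IsSimpleModule R S] : Module.length R (S →ₗ[R] Q) ≤ 1 := by
  have := IsSimpleModule.nontrivial R S
  obtain ⟨s, hs⟩ := exists_ne (0 : S)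
  have hkill : ∀ a ∈ maximalIdeal R, a • s = 0 := fun a ha => Module.mem_annihilator.1
    ((eq_maximalIdeal (IsSimpleModule.annihilator_isMaximal (M := S))).ge ha) s
  let ev : (S →ₗ[R] Q) →ₗ[R] Submodule.span R {u} :=
    (LinearMap.applyₗ s).codRestrict _ fun f => h.mem_span_of_smul_eq_zero fun a ha => by
      rw [LinearMap.applyₗ_apply_apply, ← map_smul, hkill a ha, map_zero]
  refine (Module.length_le_of_injective ev fun f g hfg => LinearMap.ext fun z => ?_).trans
    h.length_span_le
  obtain ⟨r, rfl⟩ := IsSimpleModule.toSpanSingleton_surjective R hs z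
  rw [LinearMap.toSpanSingleton_apply, map_smul, map_smul]
  exact congrArg (r • ·) (congrArg Subtype.val hfg)

theorem length_hom_le (h : IsSocleGenerator R u) {M : Type*} [AddCommGroup M] [Module R M]
    (hM : IsFiniteLength R M) : Module.length R (M →ₗ[R] Q) ≤ Module.length R M := by
  induction hM with
  | of_subsingleton => rw [Module.length_eq_zero]; exact zero_le
  | @of_simple_quotient M _ _ N _ _ ih =>
    have hexact : Function.Exact (LinearMap.lcomp R Q N.mkQ)
        (LinearMap.lcomp R Q N.subtype).rangeRestrict := by
      rw [LinearMap.exact_iff, LinearMap.ker_rangeRestrict, ← LinearMap.exact_iff]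
      exact LinearMap.exact_lcomp_of_exact_of_surjective _ (LinearMap.exact_subtype_mkQ N)
        N.mkQ_surjective
    rw [Module.length_eq_add_of_exact N.subtype N.mkQ N.injective_subtype N.mkQ_surjective
        (LinearMap.exact_subtype_mkQ N), Module.length_eq_one R (M ⧸ N), add_comm,
      Module.length_eq_add_of_exact _ _ (LinearMap.lcomp_injective_of_surjective _ N.mkQ_surjective)
        (LinearMap.surjective_rangeRestrict _) hexact]
    exact add_le_add (h.length_hom_simple_le _)
      ((Module.length_le_of_injective _ (Submodule.injective_subtype _)).trans ih)

theorem length_le (h : IsSocleGenerator R u) {J : Ideal R} (hJ : J ≤ Module.annihilator R Q)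
    (hfin : IsFiniteLength R (R ⧸ J)) : Module.length R Q ≤ Module.length R (R ⧸ J) := by
  let φ : Q →ₗ[R] (R ⧸ J →ₗ[R] Q) :=
    { toFun z := J.liftQ (LinearMap.toSpanSingleton R Q z) fun a ha => by
        simpa using Module.mem_annihilator.1 (hJ ha) z
      map_add' x y := Submodule.linearMap_qext _ (LinearMap.ext fun r => smul_add r x y)
      map_smul' r x := Submodule.linearMap_qext _ (LinearMap.ext fun s => smul_comm s r x) }
  refine (Module.length_le_of_injective φ fun x y hxy => ?_).trans (h.length_hom_le hfin)
  rw [← one_smul R x, ← one_smul R y]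
  exact LinearMap.congr_fun hxy (J.mkQ 1)

theorem length_quotient_annihilator_le (h : IsSocleGenerator R u) (hQ : IsFiniteLength R Q) :
    Module.length R (R ⧸ Module.annihilator R Q) ≤ Module.length R Q := by
  let φ : R →ₗ[R] (Q →ₗ[R] Q) := LinearMap.lsmul R Q
  have hker : LinearMap.ker φ = Module.annihilator R Q := by
    ext a
    rw [LinearMap.mem_ker, Module.mem_annihilator]
    exact LinearMap.ext_iff
  rw [← hker]
  exact (Module.length_le_of_injective ((LinearMap.ker φ).liftQ φ le_rfl)
    (LinearMap.ker_eq_bot.1 (Submodule.ker_liftQ_eq_bot _ _ _ le_rfl))).trans (h.length_hom_le hQ)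

/- Modulo the annihilator of `Q`, the module `Q` is the injective hull of the residue field: its
length is already the maximal one for a module with simple socle, so that the amalgam of `Q` and
`Q'` is no larger than `Q`. -/
theorem exists_map_eq {Q' : Type*} [AddCommGroup Q'] [Module R Q'] {u' : Q'}
    (h : IsSocleGenerator R u) (h' : IsSocleGenerator R u') (hQ : IsFiniteLength R Q)
    (hQ' : IsFiniteLength R Q') (hann : Module.annihilator R Q ≤ Module.annihilator R Q') :
    ∃ i : Q' →ₗ[R] Q, i u' = u := by
  obtain ⟨P, _, _, i, i', hPfin, heq, hP, hPann⟩ := exists_amalgam hQ hQ' h h'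
  have hi : Function.Injective i := h.injective_of_map_ne_zero i hP.1
  have hfin : IsFiniteLength R (R ⧸ Module.annihilator R Q) := Module.length_ne_top_iff.1
    (ne_top_of_le_ne_top (Module.length_ne_top_iff.2 hQ) (h.length_quotient_annihilator_le hQ))
  have hle : Module.length R P ≤ Module.length R Q :=
    (hP.length_le ((le_inf le_rfl hann).trans hPann) hfin).trans
      (h.length_quotient_annihilator_le hQ)
  have hsurj : Function.Surjective i := by
    rw [← LinearMap.range_eq_top]
    by_contra hne
    obtain ⟨_, _⟩ := isFiniteLength_iff_isNoetherian_isArtinian.1 hPfin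
    have hlt := Submodule.length_lt hne
    rw [← (LinearEquiv.ofInjective i hi).length_eq] at hlt
    exact hlt.not_ge hle
  let e := LinearEquiv.ofBijective i ⟨hi, hsurj⟩
  exact ⟨e.symm.toLinearMap ∘ₗ i', e.injective ((e.apply_symm_apply _).trans heq.symm)⟩

theorem exists_notMem_annihilator {R : Type u} [CommRing R] {J : Ideal R}
    (hfin : IsFiniteLength R (R ⧸ J)) {b : R} (hb : b ∉ J) :
    ∃ (Q : Type u) (_ : AddCommGroup Q) (_ : Module R Q) (u : Q), IsFiniteLength R Q ∧
      IsSocleGenerator R u ∧ J ≤ Module.annihilator R Q ∧ b ∉ Module.annihilator R Q := by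
  obtain ⟨_, _⟩ := isFiniteLength_iff_isNoetherian_isArtinian.1 hfin
  obtain ⟨K, -, hK⟩ := exists_mkQ (R := R) ⊥ (x := J.mkQ b)
    (by simpa [Ideal.Quotient.eq_zero_iff_mem] using hb)
  refine ⟨(R ⧸ J) ⧸ K, _, _, _, hfin.of_surjective K.mkQ_surjective, hK, ?_, fun hmem => hK.1 ?_⟩
  · exact J.annihilator_quotient.ge.trans
      (LinearMap.annihilator_le_of_surjective _ K.mkQ_surjective)
  · have := Module.mem_annihilator.1 hmem (K.mkQ (J.mkQ 1))
    rwa [← map_smul, ← map_smul, smul_eq_mul, mul_one] at this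

theorem exists_annihilator_eq {R : Type u} [CommRing R] [IsLocalRing R] {J : Ideal R}
    (hJ : J ≠ ⊤) (hfin : IsFiniteLength R (R ⧸ J)) :
    ∃ (Q : Type u) (_ : AddCommGroup Q) (_ : Module R Q) (u : Q),
      IsFiniteLength R Q ∧ IsSocleGenerator R u ∧ Module.annihilator R Q = J := by
  obtain ⟨_, _⟩ := isFiniteLength_iff_isNoetherian_isArtinian.1 hfin
  let IsAnnihilator (I : Ideal R) : Prop := J ≤ I ∧
    ∃ (Q : Type u) (_ : AddCommGroup Q) (_ : Module R Q) (u : Q),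
      IsFiniteLength R Q ∧ IsSocleGenerator R u ∧ Module.annihilator R Q = I
  obtain ⟨I, ⟨hJI, Q, _, _, u, hQ, hu, hI⟩, hmin⟩ :=
    exists_minimalFor_of_wellFoundedLT IsAnnihilator (Submodule.map J.mkQ) <| by
      obtain ⟨Q, _, _, u, hQ, hu, hJQ, -⟩ := exists_notMem_annihilator hfin
        (J.ne_top_iff_one.1 hJ)
      exact ⟨_, hJQ, Q, _, _, u, hQ, hu, rfl⟩
  refine ⟨Q, _, _, u, hQ, hu, hI.trans (le_antisymm (fun b hb => ?_) hJI)⟩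
  by_contra hbJ
  obtain ⟨Q', _, _, u', hQ', hu', hJQ', hbQ'⟩ := exists_notMem_annihilator hfin hbJ
  obtain ⟨P, _, _, i, i', hPfin, heq, hP, hann⟩ := exists_amalgam hQ hQ' hu hu'
  have hPQ : Module.annihilator R P ≤ I :=
    hI ▸ LinearMap.annihilator_le_of_injective i (hu.injective_of_map_ne_zero i hP.1)
  have hJP : J ≤ Module.annihilator R P := (le_inf (hI ▸ hJI) hJQ').trans hann
  have hle := Submodule.map_le_iff_le_comap.1
    (hmin ⟨hJP, P, _, _, _, hPfin, hP, rfl⟩ (Submodule.map_mono hPQ))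
  rw [Submodule.comap_map_mkQ, sup_eq_right.2 hJP] at hle
  exact hbQ' (LinearMap.annihilator_le_of_injective i'
    (hu'.injective_of_map_ne_zero i' (heq ▸ hP.1)) (hle hb))

end Length

end IsSocleGenerator

section Purity

variable {R : Type u} [CommRing R] {N : Type*} [AddCommGroup N] [Module R N]

theorem not_isPureMap_toSpanSingleton_iff {n : N} :
    ¬ IsPureMap (LinearMap.toSpanSingleton R N n) ↔
      ∃ (Q : Type u) (_ : AddCommGroup Q) (_ : Module R Q) (z : Q), z ≠ 0 ∧ n ⊗ₜ[R] z = 0 := by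
  have tmul_eq (Q : Type u) [AddCommGroup Q] [Module R Q] (z : Q) :
      (LinearMap.toSpanSingleton R N n).rTensor Q ((TensorProduct.lid R Q).symm z) = n ⊗ₜ z := by
    rw [TensorProduct.lid_symm_apply, LinearMap.rTensor_tmul, LinearMap.toSpanSingleton_apply,
      one_smul]
  simp only [IsPureMap, not_forall, injective_iff_map_eq_zero, exists_prop]
  refine exists_congr fun Q => exists_congr fun _ => exists_congr fun _ => ?_
  rw [(TensorProduct.lid R Q).symm.surjective.exists]
  exact exists_congr fun z => by rw [tmul_eq, LinearEquiv.map_eq_zero_iff, and_comm]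

theorem not_isPureMap_of_tmul_eq_zero {n : N} {Q : Type*} [AddCommGroup Q] [Module R Q]
    [Module.Finite R Q] {z : Q} (hz : z ≠ 0) (h : n ⊗ₜ[R] z = 0) :
    ¬ IsPureMap (LinearMap.toSpanSingleton R N n) := by
  obtain ⟨k, f, hf⟩ := Module.Finite.exists_fin' R Q
  let e := (f.quotKerEquivOfSurjective hf).symm
  have he : n ⊗ₜ[R] e z = 0 := by
    rw [← e.coe_toLinearMap, ← LinearMap.lTensor_tmul, h, map_zero]
  exact not_isPureMap_toSpanSingleton_iff.2
    ⟨_, inferInstance, inferInstance, e z, by simpa using hz, he⟩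

theorem exists_fg_tmul_eq_zero {n : N} {Q : Type*} [AddCommGroup Q] [Module R Q] {z : Q}
    (h : n ⊗ₜ[R] z = 0) :
    ∃ (Q₀ : Submodule R Q) (hz : z ∈ Q₀), Q₀.FG ∧ n ⊗ₜ[R] (⟨z, hz⟩ : Q₀) = 0 := by
  have hker : (⟨z, Submodule.mem_span_singleton_self z⟩ : Submodule.span R {z}) ⊗ₜ[R] n ∈
      LinearMap.ker ((Submodule.span R {z}).subtype.rTensor N) := by
    simpa using congrArg (TensorProduct.comm R N Q) h
  obtain ⟨Q₀, hle, hfg, h₀⟩ :=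
    TensorProduct.eq_zero_of_fg_of_subtype_eq_zero (Submodule.fg_span_singleton z) hker
  refine ⟨Q₀, hle (Submodule.mem_span_singleton_self z), hfg, ?_⟩
  have := congrArg (TensorProduct.comm R Q₀ N) h₀
  rwa [map_zero, LinearMap.rTensor_tmul, TensorProduct.comm_tmul] at this

variable [IsNoetherianRing R] [IsLocalRing R]

theorem exists_isFiniteLength_isSocleGenerator_mkQ {Q : Type*} [AddCommGroup Q] [Module R Q]
    [Module.Finite R Q] {z : Q} (hz : z ≠ 0) :
    ∃ K : Submodule R Q, IsFiniteLength R (Q ⧸ K) ∧ IsSocleGenerator R (K.mkQ z) := by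
  obtain ⟨j, hj⟩ : ∃ j : ℕ, z ∉ (maximalIdeal R ^ j • ⊤ : Submodule R Q) := by
    by_contra! hall
    refine hz ?_
    rwa [← Submodule.mem_bot R, ← Ideal.iInf_pow_smul_eq_bot_of_isLocalRing _
      (maximalIdeal.isMaximal R).ne_top, Submodule.mem_iInf]
  obtain ⟨K, hK, hu⟩ := IsSocleGenerator.exists_mkQ _ hj
  refine ⟨K, isFiniteLength_of_pow_maximalIdeal_le_annihilator (j := j) fun a ha => ?_, hu⟩
  rw [Module.mem_annihilator, K.mkQ_surjective.forall]
  intro y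
  rw [← map_smul]
  exact (Submodule.Quotient.mk_eq_zero _).2 (hK (Submodule.smul_mem_smul ha trivial))

theorem exists_of_not_isPureMap {n : N} (h : ¬ IsPureMap (LinearMap.toSpanSingleton R N n)) :
    ∃ (Q : Type u) (_ : AddCommGroup Q) (_ : Module R Q) (u : Q),
      IsFiniteLength R Q ∧ IsSocleGenerator R u ∧ n ⊗ₜ[R] u = 0 := by
  obtain ⟨Q, _, _, z, hz, hnz⟩ := not_isPureMap_toSpanSingleton_iff.1 h
  obtain ⟨Q₀, hzQ₀, hfg, h₀⟩ := exists_fg_tmul_eq_zero hnz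
  have : Module.Finite R Q₀ := Module.Finite.iff_fg.2 hfg
  obtain ⟨K, hK, hu⟩ := exists_isFiniteLength_isSocleGenerator_mkQ (R := R) (z := (⟨z, hzQ₀⟩ : Q₀))
    fun h => hz (congrArg Subtype.val h)
  exact ⟨_, _, _, _, hK, hu, by rw [← LinearMap.lTensor_tmul, h₀, map_zero]⟩

end Purity

section ImpurityIdeal

variable (A : Type u) (B : Type*) [CommRing A] [CommRing B] [Algebra A B]
  {M : Type*} [AddCommGroup M] [Module A M] [Module B M] [IsScalarTower A B M]

/-- The ideal of `B` generated by the `b` for which `A → M`, `1 ↦ b • n`, is not pure. For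
`B = A` acting through the `e`-th Frobenius on `M = F^e_* A(D)` and `n = F^e_* 1` this is
`I_e(A, D)`. -/
def impurityIdeal (n : M) : Ideal B :=
  Ideal.span {b : B | ¬ IsPureMap (LinearMap.toSpanSingleton A M (b • n))}

variable {A B}

theorem torsionOf_tmul_le_impurityIdeal (n : M) {Q : Type*} [AddCommGroup Q] [Module A Q]
    [Module.Finite A Q] {z : Q} (hz : z ≠ 0) :
    Ideal.torsionOf B (M ⊗[A] Q) (n ⊗ₜ z) ≤ impurityIdeal A B n := fun b hb =>
  Ideal.subset_span (not_isPureMap_of_tmul_eq_zero hz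
    (by rwa [Ideal.mem_torsionOf_iff, TensorProduct.smul_tmul'] at hb))

theorem torsionOf_tmul_le_torsionOf_tmul_map (n : M) {Q P : Type*} [AddCommGroup Q] [Module A Q]
    [AddCommGroup P] [Module A P] (i : Q →ₗ[A] P) (z : Q) :
    Ideal.torsionOf B (M ⊗[A] Q) (n ⊗ₜ z) ≤ Ideal.torsionOf B (M ⊗[A] P) (n ⊗ₜ i z) := by
  intro b hb
  rw [Ideal.mem_torsionOf_iff, TensorProduct.smul_tmul'] at hb ⊢
  rw [← LinearMap.lTensor_tmul, hb, map_zero]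

variable [IsNoetherianRing A] [IsLocalRing A] [IsNoetherianRing B]

theorem exists_torsionOf_eq_impurityIdeal (n : M) :
    ∃ (Q : Type u) (_ : AddCommGroup Q) (_ : Module A Q) (u : Q), IsFiniteLength A Q ∧
      IsSocleGenerator A u ∧ Ideal.torsionOf B (M ⊗[A] Q) (n ⊗ₜ u) = impurityIdeal A B n := by
  let IsTorsion (I : Ideal B) : Prop := ∃ (Q : Type u) (_ : AddCommGroup Q) (_ : Module A Q)
    (u : Q), IsFiniteLength A Q ∧ IsSocleGenerator A u ∧
      Ideal.torsionOf B (M ⊗[A] Q) (n ⊗ₜ u) = I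
  obtain ⟨_, ⟨Q, _, _, u, hQ, hu, rfl⟩, hmax⟩ :=
    exists_maximalFor_of_wellFoundedGT IsTorsion id <| by
      obtain ⟨K, hK, hu⟩ := exists_isFiniteLength_isSocleGenerator_mkQ (R := A) (Q := A) one_ne_zero
      exact ⟨_, A ⧸ K, _, _, _, hK, hu, rfl⟩
  obtain ⟨_, _⟩ := isFiniteLength_iff_isNoetherian_isArtinian.1 hQ
  refine ⟨Q, _, _, u, hQ, hu,
    (torsionOf_tmul_le_impurityIdeal n hu.1).antisymm (Ideal.span_le.2 fun b hb => ?_)⟩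
  obtain ⟨Q', _, _, u', hQ', hu', hb'⟩ := exists_of_not_isPureMap hb
  obtain ⟨P, _, _, i, i', hP, heq, hiu, -⟩ := IsSocleGenerator.exists_amalgam hQ hQ' hu hu'
  refine hmax ⟨P, _, _, _, hP, hiu, rfl⟩ (torsionOf_tmul_le_torsionOf_tmul_map n i u) ?_
  rw [id, heq]
  refine torsionOf_tmul_le_torsionOf_tmul_map n i' u' ?_
  rw [Ideal.mem_torsionOf_iff, TensorProduct.smul_tmul', hb']

theorem not_isPureMap_of_mem_impurityIdeal {n : M} {b : B} (hb : b ∈ impurityIdeal A B n) :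
    ¬ IsPureMap (LinearMap.toSpanSingleton A M (b • n)) := by
  obtain ⟨Q, _, _, u, hQ, hu, h⟩ := exists_torsionOf_eq_impurityIdeal (A := A) (B := B) n
  obtain ⟨_, _⟩ := isFiniteLength_iff_isNoetherian_isArtinian.1 hQ
  rw [← h, Ideal.mem_torsionOf_iff, TensorProduct.smul_tmul'] at hb
  exact not_isPureMap_of_tmul_eq_zero hu.1 hb

theorem map_maximalIdeal_le_impurityIdeal (n : M) :
    (maximalIdeal A).map (algebraMap A B) ≤ impurityIdeal A B n := by
  obtain ⟨Q, _, _, u, -, hu, h⟩ := exists_torsionOf_eq_impurityIdeal (A := A) (B := B) n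
  rw [Ideal.map_le_iff_le_comap, ← h]
  intro a ha
  rw [Ideal.mem_comap, Ideal.mem_torsionOf_iff, algebraMap_smul, ← TensorProduct.tmul_smul,
    hu.smul_eq_zero ha, tmul_zero]

end ImpurityIdeal

section Flat

variable {A : Type*} [CommRing A] {S : Type*} [AddCommGroup S] [Module A S]

theorem tmul_eq_zero_iff_mem_torsionOf_smul_top [Module.Flat A S] {W : Type*} [AddCommGroup W]
    [Module A W] {s : S} {w : W} :
    s ⊗ₜ[A] w = 0 ↔ s ∈ (Ideal.torsionOf A W w • ⊤ : Submodule A S) := by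
  let f : (A ⧸ Ideal.torsionOf A W w) →ₗ[A] W :=
    (Ideal.torsionOf A W w).liftQ (LinearMap.toSpanSingleton A W w) le_rfl
  have hf : Function.Injective f :=
    LinearMap.ker_eq_bot.1 (Submodule.ker_liftQ_eq_bot _ _ _ le_rfl)
  have hs : f.lTensor S (s ⊗ₜ Ideal.Quotient.mk _ 1) = s ⊗ₜ w :=
    congrArg (s ⊗ₜ ·) (one_smul A w)
  rw [← hs, map_eq_zero_iff _ (Module.Flat.lTensor_preserves_injective_linearMap f hf),
    ← LinearEquiv.map_eq_zero_iff (tensorQuotEquivQuotSMul S _),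
    tensorQuotEquivQuotSMul_tmul_mk, one_smul, Submodule.Quotient.mk_eq_zero]

theorem rTensor_lTensor_apply {N P P' : Type*} [AddCommGroup N] [Module A N] [AddCommGroup P]
    [Module A P] [AddCommGroup P'] [Module A P'] (f : S →ₗ[A] N) (h : P →ₗ[A] P') (x : S ⊗[A] P) :
    f.rTensor P' (h.lTensor S x) = h.lTensor N (f.rTensor P x) := by
  simp only [← LinearMap.comp_apply, LinearMap.rTensor_comp_lTensor, LinearMap.lTensor_comp_rTensor]

theorem rTensor_injective_of_isFiniteLength [IsLocalRing A] {N : Type*} [AddCommGroup N]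
    [Module A N] [Module.Flat A N] (f : S →ₗ[A] N)
    (hf : Function.Injective (f.rTensor (A ⧸ maximalIdeal A))) {Q : Type*} [AddCommGroup Q]
    [Module A Q] (hQ : IsFiniteLength A Q) : Function.Injective (f.rTensor Q) := by
  induction hQ with
  | of_subsingleton => exact Function.injective_of_subsingleton _
  | @of_simple_quotient Q _ _ L hL _ ih =>
    obtain ⟨I, hI, ⟨e⟩⟩ := isSimpleModule_iff_quot_maximal.1 hL
    obtain rfl := eq_maximalIdeal hI
    let g : Q →ₗ[A] A ⧸ maximalIdeal A := e.toLinearMap ∘ₗ L.mkQ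
    have hex : Function.Exact L.subtype g :=
      (LinearMap.exact_subtype_mkQ L).comp_injective _ e.injective e.map_zero
    refine (injective_iff_map_eq_zero _).2 fun x hx => ?_
    obtain ⟨x, rfl⟩ := (lTensor_exact S hex (e.surjective.comp L.mkQ_surjective) x).1
      ((map_eq_zero_iff _ hf).1 (by rw [rTensor_lTensor_apply, hx, map_zero]))
    rw [rTensor_lTensor_apply, map_eq_zero_iff _
      (Module.Flat.lTensor_preserves_injective_linearMap _ L.injective_subtype),
      map_eq_zero_iff _ ih] at hx
    rw [hx, map_zero]

variable {R : Type*} [CommRing R] [Algebra A R]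

theorem torsionOf_quotient_one (I : Ideal A) : Ideal.torsionOf A (A ⧸ I) 1 = I := by
  ext a
  rw [Ideal.mem_torsionOf_iff, Algebra.smul_def, mul_one, Ideal.Quotient.algebraMap_eq,
    Ideal.Quotient.eq_zero_iff_mem]

theorem mk_tmul_eq_zero_iff {J : Ideal R} [Module.Flat A (R ⧸ J)] {W : Type*} [AddCommGroup W]
    [Module A W] {r : R} {w : W} :
    Ideal.Quotient.mk J r ⊗ₜ[A] w = 0 ↔
      r ∈ (Ideal.torsionOf A W w).map (algebraMap A R) ⊔ J := by
  have hmap (I : Ideal A) : I.map (algebraMap A (R ⧸ J)) =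
      (I.map (algebraMap A R)).map (Ideal.Quotient.mk J) := by
    rw [Ideal.map_map]
    rfl
  rw [tmul_eq_zero_iff_mem_torsionOf_smul_top, Ideal.smul_top_eq_map,
    Submodule.restrictScalars_mem, hmap, ← Ideal.mem_comap,
    Ideal.comap_map_of_surjective _ Ideal.Quotient.mk_surjective, ← RingHom.ker_eq_comap_bot,
    Ideal.mk_ker]

theorem annihilator_quotient_tensor_le {J : Ideal R} [Module.Flat A (R ⧸ J)] (Q : Type*)
    [AddCommGroup Q] [Module A Q] [Module.Finite A Q] :
    Module.annihilator R ((R ⧸ J) ⊗[A] Q) ≤ (Module.annihilator A Q).map (algebraMap A R) ⊔ J := by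
  intro r hr
  obtain ⟨k, q, hq⟩ := Module.Finite.exists_fin (R := A) (M := Q)
  have htor : Ideal.torsionOf A (Fin k → Q) q = Module.annihilator A Q := by
    ext a
    rw [Ideal.mem_torsionOf_iff, ← Submodule.annihilator_top, ← hq, Submodule.mem_annihilator_span,
      Set.forall_subtype_range_iff, funext_iff]
    rfl
  rw [← htor, ← mk_tmul_eq_zero_iff]
  apply (TensorProduct.piRight A A (R ⧸ J) fun _ : Fin k => Q).injective
  ext i
  have h := Module.mem_annihilator.1 hr (1 ⊗ₜ q i)
  rw [TensorProduct.smul_tmul', Algebra.smul_def, mul_one] at h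
  simpa using h

end Flat

section LocalCriterion

open RingTheory.Sequence

variable {A R : Type*} [CommRing A] [CommRing R] [Algebra A R] [IsLocalRing A]
  {S : Type*} [AddCommGroup S] [Module R S] [Module A S] [IsScalarTower A R S]

/-- The canonical isomorphism `S/yS ⊗ Q ≅ (S ⊗ Q)/y(S ⊗ Q)`, which passes regularity of `y` on a
tensor product to quotients of its first factor. -/
def quotSMulTopTensorEquiv (y : R) (S Q : Type*) [AddCommGroup S] [Module R S] [Module A S]
    [IsScalarTower A R S] [AddCommGroup Q] [Module A Q] :
    QuotSMulTop y S ⊗[A] Q ≃ₗ[R] QuotSMulTop y (S ⊗[A] Q) :=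
  (AlgebraTensorModule.congr (QuotSMulTop.equivQuotTensor y S) (LinearEquiv.refl A Q)) ≪≫ₗ
    AlgebraTensorModule.assoc A R R (R ⧸ Ideal.span {y}) S Q ≪≫ₗ
    (QuotSMulTop.equivQuotTensor y (S ⊗[A] Q)).symm

theorem isSMulRegular_tensor_of_isFiniteLength [Module.Flat A S] {y : R}
    (hy : IsSMulRegular (S ⊗[A] (A ⧸ maximalIdeal A)) y) {Q : Type*} [AddCommGroup Q] [Module A Q]
    (hQ : IsFiniteLength A Q) : IsSMulRegular (S ⊗[A] Q) y :=
  rTensor_injective_of_isFiniteLength (Module.toModuleEnd A S y) hy hQ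

variable [IsLocalRing R] [IsNoetherianRing R]
  [IsLocalHom (algebraMap A R)] [Module.Finite R S]

variable (R) in
theorem eq_zero_of_forall_lTensor_mkQ_eq_zero {Q : Type*} [AddCommGroup Q] [Module A Q]
    [Module.Finite A Q] {z : S ⊗[A] Q} (h : ∀ j : ℕ,
      AlgebraTensorModule.lTensor R S (maximalIdeal A ^ j • ⊤ : Submodule A Q).mkQ z = 0) :
    z = 0 := by
  have : Module.Finite R (S ⊗[A] Q) :=
    Module.Finite.equiv (AlgebraTensorModule.cancelBaseChange A R R S Q)
  suffices hz : z ∈ (⨅ j : ℕ, maximalIdeal R ^ j • ⊤ : Submodule R (S ⊗[A] Q)) by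
    rwa [Ideal.iInf_pow_smul_eq_bot_of_isLocalRing _ (maximalIdeal.isMaximal R).ne_top] at hz
  refine (Submodule.mem_iInf _).2 fun j => ?_
  have hm : (maximalIdeal A ^ j).map (algebraMap A R) ≤ maximalIdeal R ^ j := by
    rw [Ideal.map_pow]
    exact Ideal.pow_right_mono (((local_hom_TFAE (algebraMap A R)).out 0 2 :
      IsLocalHom (algebraMap A R) ↔ _).1 inferInstance) j
  obtain ⟨t, rfl⟩ := (lTensor_exact S (LinearMap.exact_subtype_mkQ _)
    (Submodule.mkQ_surjective _) z).1 (h j)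
  clear h
  induction t with
  | zero => simp
  | add x y hx hy => rw [map_add]; exact add_mem hx hy
  | tmul s q =>
    obtain ⟨q, hq⟩ := q
    change s ⊗ₜ[A] q ∈ _
    refine Submodule.smul_induction_on hq (fun a ha q _ => ?_) fun q q' hq hq' => ?_
    · rw [TensorProduct.tmul_smul, ← algebraMap_smul R a]
      exact Submodule.smul_mem_smul (hm (Ideal.mem_map_of_mem _ ha)) trivial
    · rw [TensorProduct.tmul_add]
      exact add_mem hq hq'

variable [Module.Flat A S] [IsNoetherianRing A]

theorem isSMulRegular_tensor_of_residue {y : R}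
    (hy : IsSMulRegular (S ⊗[A] (A ⧸ maximalIdeal A)) y) (Q : Type*) [AddCommGroup Q]
    [Module A Q] [Module.Finite A Q] : IsSMulRegular (S ⊗[A] Q) y := by
  refine IsSMulRegular.of_right_eq_zero_of_smul fun z hz =>
    eq_zero_of_forall_lTensor_mkQ_eq_zero R fun j => ?_
  have hQ : IsFiniteLength A (Q ⧸ (maximalIdeal A ^ j • ⊤ : Submodule A Q)) :=
    isFiniteLength_of_pow_maximalIdeal_le_annihilator (j := j) fun a ha => by
      rw [Module.mem_annihilator, (Submodule.mkQ_surjective _).forall]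
      intro q
      rw [← map_smul]
      exact (Submodule.Quotient.mk_eq_zero _).2 (Submodule.smul_mem_smul ha trivial)
  refine (isSMulRegular_tensor_of_isFiniteLength hy hQ).right_eq_zero_of_smul ?_
  rw [← map_smul, hz, map_zero]

theorem flat_quotSMulTop_of_residue {y : R}
    (hy : IsSMulRegular (S ⊗[A] (A ⧸ maximalIdeal A)) y) : Module.Flat A (QuotSMulTop y S) := by
  rw [Module.Flat.iff_lTensor_injective']
  intro I
  let ι := AlgebraTensorModule.lTensor R S I.subtype
  have hι : Function.Injective ι :=
    Module.Flat.lTensor_preserves_injective_linearMap _ I.injective_subtype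
  have hex : Function.Exact ι (AlgebraTensorModule.lTensor R S I.mkQ) :=
    lTensor_exact S (LinearMap.exact_subtype_mkQ I) I.mkQ_surjective
  have hmap : Function.Injective (QuotSMulTop.map y ι) := by
    have h := QuotSMulTop.map_first_exact_on_four_term_exact_of_isSMulRegular_last
      ((LinearMap.exact_zero_iff_injective PUnit ι).2 hι) hex
      (isSMulRegular_tensor_of_residue hy (A ⧸ I))
    rw [map_zero] at h
    exact (LinearMap.exact_zero_iff_injective _ _).1 h
  have hcomm : QuotSMulTop.map y ι ∘ₗ (quotSMulTopTensorEquiv y S I).toLinearMap =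
      (quotSMulTopTensorEquiv y S A).toLinearMap ∘ₗ
        AlgebraTensorModule.lTensor R (QuotSMulTop y S) I.subtype := by
    ext s q
    rfl
  refine .of_comp (f := quotSMulTopTensorEquiv y S A) ?_
  have h := hmap.comp (quotSMulTopTensorEquiv y S I).injective
  rwa [← LinearEquiv.coe_toLinearMap, ← LinearMap.coe_comp, hcomm, LinearMap.coe_comp] at h

theorem flat_quotient_of_isWeaklyRegular {l : List R}
    (hl : IsWeaklyRegular (S ⊗[A] (A ⧸ maximalIdeal A)) l) :
    Module.Flat A (S ⧸ (Ideal.ofList l • ⊤ : Submodule R S)) := by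
  induction l generalizing S with
  | nil =>
    let e : (S ⧸ (Ideal.ofList ([] : List R) • ⊤ : Submodule R S)) ≃ₗ[R] S :=
      Submodule.quotEquivOfEqBot _ (by rw [Ideal.ofList_nil, Submodule.bot_smul])
    exact .of_linearEquiv (e.restrictScalars A)
  | cons y l ih =>
    rw [isWeaklyRegular_cons_iff] at hl
    have := flat_quotSMulTop_of_residue hl.1
    have := ih ((quotSMulTopTensorEquiv y S _).isWeaklyRegular_congr l |>.2 hl.2)
    exact .of_linearEquiv
      ((Submodule.quotOfListConsSMulTopEquivQuotSMulTopInner S y l).restrictScalars A)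

end LocalCriterion

section SocleBaseChange

theorem exists_smul_ne_zero_of_pow_smul {A W : Type*} [CommRing A] [AddCommGroup W] [Module A W]
    {I : Ideal A} {j : ℕ} {z : W} (hz : z ≠ 0) (h : ∀ a ∈ I ^ j, a • z = 0) :
    ∃ a : A, a • z ≠ 0 ∧ ∀ b ∈ I, b • a • z = 0 := by
  induction j with
  | zero => exact absurd (by simpa using h 1 (by simp)) hz
  | succ j ih =>
    by_cases hj : ∀ a ∈ I ^ j, a • z = 0
    · exact ih hj
    · push Not at hj
      obtain ⟨a, ha, hne⟩ := hj
      refine ⟨a, hne, fun b hb => ?_⟩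
      rw [smul_smul]
      exact h _ (by rw [pow_succ']; exact Ideal.mul_mem_mul hb ha)

variable {A : Type*} [CommRing A] [IsLocalRing A] [IsNoetherianRing A] {S Q : Type*}
  [AddCommGroup S] [Module A S] [Module.Flat A S] [AddCommGroup Q] [Module A Q] {u : Q}

theorem IsSocleGenerator.exists_tmul_eq (hu : IsSocleGenerator A u) {z : S ⊗[A] Q}
    (hz : ∀ a ∈ maximalIdeal A, a • z = 0) : ∃ s : S, s ⊗ₜ u = z := by
  obtain ⟨G, hG⟩ := (maximalIdeal A).fg_of_isNoetherianRing
  have hGm : ∀ a ∈ G, a ∈ maximalIdeal A := fun a ha => hG ▸ Ideal.subset_span ha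
  let f : Q →ₗ[A] (G → Q) := LinearMap.pi fun a => LinearMap.lsmul A Q (a : A)
  have hex : Function.Exact (LinearMap.toSpanSingleton A Q u) f := by
    rw [LinearMap.exact_iff, LinearMap.range_toSpanSingleton]
    refine le_antisymm (fun q hq => hu.mem_span_of_smul_eq_zero fun a ha => ?_)
      ((Submodule.span_singleton_le_iff_mem _ _).2 (funext fun a => hu.smul_eq_zero (hGm a a.2)))
    have hle : maximalIdeal A ≤ Ideal.torsionOf A Q q := by
      rw [← hG]
      exact Ideal.span_le.2 fun b hb => congrFun hq ⟨b, hb⟩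
    exact (Ideal.mem_torsionOf_iff _ _).1 (hle ha)
  have hfz : f.lTensor S z = 0 := by
    classical
    apply (TensorProduct.piRight A A S (fun _ : G => Q)).injective
    ext a
    have hcomp : LinearMap.proj a ∘ₗ (TensorProduct.piRight A A S (fun _ : G => Q)).toLinearMap ∘ₗ
        f.lTensor S = LinearMap.lsmul A (S ⊗[A] Q) (a : A) :=
      TensorProduct.ext' fun s q => by simp [f]
    have := LinearMap.congr_fun hcomp z
    simpa [hz a (hGm a a.2)] using this
  obtain ⟨t, rfl⟩ := (Module.Flat.lTensor_exact S hex z).1 hfz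
  obtain ⟨s, rfl⟩ := (TensorProduct.rid A S).symm.surjective t
  exact ⟨s, by simp⟩

theorem IsSocleGenerator.tmul {R : Type*} [CommRing R] [Algebra A R] [Module R S]
    [IsScalarTower A R S] (hu : IsSocleGenerator A u) (hQ : IsFiniteLength A Q) {σ : S}
    (hσ : IsSocleGenerator R (σ ⊗ₜ[A] (1 : A ⧸ maximalIdeal A))) :
    IsSocleGenerator R (σ ⊗ₜ[A] u) := by
  let j : (A ⧸ maximalIdeal A) →ₗ[A] Q := (maximalIdeal A).liftQ (LinearMap.toSpanSingleton A Q u)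
    hu.torsionOf_eq.ge
  have hj : Function.Injective j :=
    LinearMap.ker_eq_bot.1 (Submodule.ker_liftQ_eq_bot _ _ _ hu.torsionOf_eq.le)
  let i := AlgebraTensorModule.lTensor R S j
  have hi : Function.Injective i := Module.Flat.lTensor_preserves_injective_linearMap j hj
  have hi_tmul (s : S) : i (s ⊗ₜ 1) = s ⊗ₜ u := congrArg (s ⊗ₜ ·) (one_smul A u)
  refine ⟨by rw [← hi_tmul]; exact (map_ne_zero_iff i hi).2 hσ.1, fun z hz => ?_⟩
  obtain ⟨k, hk⟩ := exists_pow_maximalIdeal_le_annihilator hQ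
  obtain ⟨a, ha, hma⟩ := exists_smul_ne_zero_of_pow_smul hz fun b hb => by
    have hb0 : b • (LinearMap.id : Q →ₗ[A] Q) = 0 :=
      LinearMap.ext (Module.mem_annihilator.1 (hk hb))
    have h := LinearMap.lTensor_smul S b (LinearMap.id : Q →ₗ[A] Q)
    rw [hb0, LinearMap.lTensor_zero, LinearMap.lTensor_id] at h
    exact (LinearMap.congr_fun h z).symm
  obtain ⟨s, hs⟩ := hu.exists_tmul_eq hma
  rw [← hs, ← hi_tmul, map_ne_zero_iff i hi] at ha
  obtain ⟨r, hr⟩ := hσ.2 _ ha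
  refine ⟨r * algebraMap A R a, ?_⟩
  rw [mul_smul, algebraMap_smul, ← hs, ← hi_tmul, ← map_smul, hr, hi_tmul]

end SocleBaseChange

section RegularElement

open scoped Pointwise

variable {R : Type*} [CommRing R] {E : Type*} [AddCommGroup E] [Module R E] {y : R}

theorem quotSMulTop_mk_eq_zero_iff {z : E} :
    (Submodule.Quotient.mk z : QuotSMulTop y E) = 0 ↔ ∃ c, y • c = z := by
  simp [Submodule.Quotient.mk_eq_zero, Submodule.mem_smul_pointwise_iff_exists]

theorem quotSMulTop_mk_pow_smul_eq_zero_iff (hy : IsSMulRegular E y) (t : ℕ) {z : E} :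
    (Submodule.Quotient.mk (y ^ t • z) : QuotSMulTop (y ^ (t + 1)) E) = 0 ↔
      (Submodule.Quotient.mk z : QuotSMulTop y E) = 0 := by
  simp only [quotSMulTop_mk_eq_zero_iff, pow_succ, mul_smul, (hy.pow t).eq_iff]

/-- Multiplication by `y ^ t` as a map `E/yE → E/y^(t+1)E`. -/
def quotSMulTopMulPow (y : R) (E : Type*) [AddCommGroup E] [Module R E] (t : ℕ) :
    QuotSMulTop y E →ₗ[R] QuotSMulTop (y ^ (t + 1)) E :=
  Submodule.mapQ _ _ (LinearMap.lsmul R E (y ^ t)) fun z hz => by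
    obtain ⟨c, -, rfl⟩ := (Submodule.mem_smul_pointwise_iff_exists _ _ _).1 hz
    rw [Submodule.mem_comap, LinearMap.lsmul_apply, smul_smul, ← pow_succ]
    exact Submodule.smul_mem_pointwise_smul _ _ _ trivial

theorem length_quotSMulTop_pow (hy : IsSMulRegular E y) (t : ℕ) :
    Module.length R (QuotSMulTop (y ^ t) E) = t * Module.length R (QuotSMulTop y E) := by
  induction t with
  | zero =>
    rw [pow_zero, Nat.cast_zero, zero_mul, Module.length_eq_zero_iff,
      Submodule.Quotient.subsingleton_iff, one_smul]
  | succ t ih =>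
    have hle : y ^ (t + 1) • (⊤ : Submodule R E) ≤ y ^ t • ⊤ := by
      rw [← Submodule.ideal_span_singleton_smul, ← Submodule.ideal_span_singleton_smul]
      exact Submodule.smul_mono_left (
        Ideal.span_singleton_le_span_singleton.2 (pow_dvd_pow _ t.le_succ))
    have hex : Function.Exact (quotSMulTopMulPow y E t) (Submodule.factor hle) := by
      intro z
      obtain ⟨z, rfl⟩ := Submodule.Quotient.mk_surjective _ z
      constructor
      · intro h
        obtain ⟨c, rfl⟩ := quotSMulTop_mk_eq_zero_iff.1 h
        exact ⟨Submodule.Quotient.mk c, rfl⟩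
      · rintro ⟨c, hc⟩
        obtain ⟨c, rfl⟩ := Submodule.Quotient.mk_surjective _ c
        rw [← hc]
        exact quotSMulTop_mk_eq_zero_iff.2 ⟨c, rfl⟩
    have hinj : Function.Injective (quotSMulTopMulPow y E t) := by
      rw [injective_iff_map_eq_zero, (Submodule.Quotient.mk_surjective _).forall]
      exact fun z => (quotSMulTop_mk_pow_smul_eq_zero_iff hy t).1
    rw [Module.length_eq_add_of_exact _ _ hinj (Submodule.factor_surjective hle) hex, ih,
      Nat.cast_succ, add_mul, one_mul, add_comm]

theorem IsSocleGenerator.quotSMulTop_pow (hy : IsSMulRegular E y) {u : E}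
    (hu : IsSocleGenerator R (Submodule.Quotient.mk u : QuotSMulTop y E)) (t : ℕ) :
    IsSocleGenerator R (Submodule.Quotient.mk (y ^ t • u) : QuotSMulTop (y ^ (t + 1)) E) := by
  refine ⟨mt (quotSMulTop_mk_pow_smul_eq_zero_iff hy t).1 hu.1, fun z hz => ?_⟩
  obtain ⟨z, rfl⟩ := Submodule.Quotient.mk_surjective _ z
  have hdvd : ∃ k, k ≤ t ∧ (∃ w, y ^ k • w = z) ∧ ¬ ∃ w, y ^ (k + 1) • w = z := by
    by_contra! h
    refine hz (quotSMulTop_mk_eq_zero_iff.2 ?_)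
    have hk (k : ℕ) (hk : k ≤ t + 1) : ∃ w, y ^ k • w = z := by
      induction k with
      | zero => exact ⟨z, by simp⟩
      | succ k ih => exact h k (by omega) (ih (by omega))
    exact hk _ le_rfl
  obtain ⟨k, hkt, ⟨w, rfl⟩, hk⟩ := hdvd
  have hw : (Submodule.Quotient.mk w : QuotSMulTop y E) ≠ 0 := fun h => by
    obtain ⟨c, rfl⟩ := quotSMulTop_mk_eq_zero_iff.1 h
    exact hk ⟨c, by rw [pow_succ, mul_smul]⟩
  obtain ⟨r, hr⟩ := hu.2 _ hw
  obtain ⟨c, hc⟩ := Nat.exists_eq_add_of_le hkt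
  refine ⟨r * y ^ c, ?_⟩
  have := congrArg (quotSMulTopMulPow y E t) hr
  rw [← Submodule.Quotient.mk_smul, smul_smul]
  refine Eq.trans (congrArg _ ?_) this
  change _ = y ^ t • r • w
  rw [smul_smul, hc]
  ring_nf

end RegularElement

section RegularSequence

open RingTheory.Sequence

variable {R : Type*} [CommRing R] [IsLocalRing R] {C : Type*} [AddCommGroup C] [Module R C]
  [IsNoetherian R C]

theorem isSMulRegular_quotient_of_isWeaklyRegular_cons {y : R} {l : List R}
    (hl : ∀ x ∈ y :: l, x ∈ maximalIdeal R) (h : IsWeaklyRegular C (y :: l)) :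
    IsSMulRegular (C ⧸ (Ideal.ofList l • ⊤ : Submodule R C)) y := by
  have := isWeaklyRegular_of_perm_of_subset_maximalIdeal h (List.perm_append_singleton y l).symm hl
  exact (isWeaklyRegular_singleton_iff _ _).1 ((isWeaklyRegular_append_iff _ _ _).1 this).2

theorem isWeaklyRegular_cons_pow {y : R} {l : List R} (hl : ∀ x ∈ y :: l, x ∈ maximalIdeal R)
    (h : IsWeaklyRegular C (y :: l)) (t : ℕ) : IsWeaklyRegular C (y ^ (t + 1) :: l) := by
  have h₁ := isWeaklyRegular_of_perm_of_subset_maximalIdeal h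
    (List.perm_append_singleton y l).symm hl
  have h₂ : IsWeaklyRegular C (l ++ [y ^ (t + 1)]) := (isWeaklyRegular_append_iff _ _ _).2
    ⟨((isWeaklyRegular_append_iff _ _ _).1 h₁).1, (isWeaklyRegular_singleton_iff _ _).2
      ((isSMulRegular_quotient_of_isWeaklyRegular_cons hl h).pow _)⟩
  refine isWeaklyRegular_of_perm_of_subset_maximalIdeal h₂ (List.perm_append_singleton _ l) ?_
  simp only [List.mem_append, List.mem_singleton]
  rintro x (hx | rfl)
  · exact hl x (List.mem_cons_of_mem _ hx)
  · exact Ideal.pow_mem_of_mem _ (hl y List.mem_cons_self) _ t.succ_pos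

theorem isWeaklyRegular_map_pow {l : List R} (hl : ∀ x ∈ l, x ∈ maximalIdeal R)
    (h : IsWeaklyRegular C l) (t : ℕ) : IsWeaklyRegular C (l.map (· ^ (t + 1))) := by
  induction l generalizing C with
  | nil => exact .nil R C
  | cons y l ih =>
    have h' := (isWeaklyRegular_cons_iff _ _ _).1 (isWeaklyRegular_cons_pow hl h t)
    exact (isWeaklyRegular_cons_iff _ _ _).2
      ⟨h'.1, ih (fun x hx => hl x (List.mem_cons_of_mem _ hx)) h'.2⟩

theorem length_quotient_ofList_map_pow {l : List R} (hl : ∀ x ∈ l, x ∈ maximalIdeal R)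
    (h : IsWeaklyRegular C l) (t : ℕ) :
    Module.length R (C ⧸ (Ideal.ofList (l.map (· ^ (t + 1))) • ⊤ : Submodule R C)) =
      ((t + 1) ^ l.length : ℕ) * Module.length R (C ⧸ (Ideal.ofList l • ⊤ : Submodule R C)) := by
  induction l generalizing C with
  | nil => rw [List.map_nil, List.length_nil, pow_zero, Nat.cast_one, one_mul]
  | cons y l ih =>
    have h' := (isWeaklyRegular_cons_iff _ _ _).1 (isWeaklyRegular_cons_pow hl h t)
    rw [List.map_cons, (Submodule.quotOfListConsSMulTopEquivQuotSMulTopInner C _ _).length_eq,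
      ih (fun x hx => hl x (List.mem_cons_of_mem _ hx)) h'.2,
      ← (Submodule.quotOfListConsSMulTopEquivQuotSMulTopInner C _ _).length_eq,
      (Submodule.quotOfListConsSMulTopEquivQuotSMulTopOuter C _ _).length_eq,
      length_quotSMulTop_pow (isSMulRegular_quotient_of_isWeaklyRegular_cons hl h),
      ← (Submodule.quotOfListConsSMulTopEquivQuotSMulTopOuter C _ _).length_eq,
      List.length_cons, pow_succ, Nat.cast_mul, mul_assoc]

theorem IsSocleGenerator.quotient_ofList_map_pow {l : List R} (hl : ∀ x ∈ l, x ∈ maximalIdeal R)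
    (h : IsWeaklyRegular C l) {u : C}
    (hu : IsSocleGenerator R (Submodule.Quotient.mk u : C ⧸ (Ideal.ofList l • ⊤ : Submodule R C)))
    (t : ℕ) : IsSocleGenerator R (Submodule.Quotient.mk (l.prod ^ t • u) :
      C ⧸ (Ideal.ofList (l.map (· ^ (t + 1))) • ⊤ : Submodule R C)) := by
  induction l generalizing C with
  | nil => simpa using hu
  | cons y l ih =>
    have h' := (isWeaklyRegular_cons_iff _ _ _).1 (isWeaklyRegular_cons_pow hl h t)
    have hy := (hu.map_equiv (Submodule.quotOfListConsSMulTopEquivQuotSMulTopOuter C y l)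
      ).quotSMulTop_pow (isSMulRegular_quotient_of_isWeaklyRegular_cons hl h) t
    have hyl := (hy.map_equiv
      (Submodule.quotOfListConsSMulTopEquivQuotSMulTopOuter C (y ^ (t + 1)) l).symm).map_equiv
      (Submodule.quotOfListConsSMulTopEquivQuotSMulTopInner C (y ^ (t + 1)) l)
    have := (ih (u := Submodule.Quotient.mk (y ^ t • u))
      (fun x hx => hl x (List.mem_cons_of_mem _ hx)) h'.2 hyl).map_equiv
      (Submodule.quotOfListConsSMulTopEquivQuotSMulTopInner C (y ^ (t + 1))
        (l.map (· ^ (t + 1)))).symm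
    rw [List.prod_cons, mul_pow, mul_comm, mul_smul]
    exact this

end RegularSequence

section Fibre

variable {A R : Type*} [CommRing A] [CommRing R] [Algebra A R]

/-- The canonical isomorphism `(R ⊗ W)/J(R ⊗ W) ≅ R/J ⊗ W`. -/
def quotSMulTopTensorEquivQuotTensor (J : Ideal R) (W : Type*) [AddCommGroup W] [Module A W] :
    ((R ⊗[A] W) ⧸ (J • ⊤ : Submodule R (R ⊗[A] W))) ≃ₗ[R] (R ⧸ J) ⊗[A] W :=
  (quotTensorEquivQuotSMul (R ⊗[A] W) J).symm ≪≫ₗ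
    AlgebraTensorModule.cancelBaseChange A R R (R ⧸ J) W

theorem quotSMulTopTensorEquivQuotTensor_mk {J : Ideal R} {W : Type*} [AddCommGroup W] [Module A W]
    (r : R) (x : W) :
    quotSMulTopTensorEquivQuotTensor (A := A) J W (Submodule.Quotient.mk (r ⊗ₜ x)) =
      Ideal.Quotient.mk J r ⊗ₜ x := by
  rw [quotSMulTopTensorEquivQuotTensor, LinearEquiv.trans_apply,
    ← quotTensorEquivQuotSMul_mk_one_tmul, LinearEquiv.symm_apply_apply,
    AlgebraTensorModule.cancelBaseChange_tmul, Algebra.smul_def, mul_one]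
  rfl

/-- The canonical isomorphism `R/J ⊗ A/I ≅ R/(IR + J)`. -/
def quotTensorQuotEquiv (J : Ideal R) (I : Ideal A) :
    (R ⧸ J) ⊗[A] (A ⧸ I) ≃ₗ[R] R ⧸ I.map (algebraMap A R) ⊔ J :=
  ((I.qoutMapEquivTensorQout (R ⧸ J)).symm.restrictScalars R) ≪≫ₗ
    (Ideal.quotientEquivAlgOfEq R (by
      rw [IsScalarTower.algebraMap_eq A R (R ⧸ J), ← Ideal.map_map]; rfl)).toLinearEquiv ≪≫ₗ
    (DoubleQuot.quotQuotEquivQuotSupₐ R J (I.map (algebraMap A R))).toLinearEquiv ≪≫ₗ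
    (Ideal.quotientEquivAlgOfEq R (sup_comm _ _)).toLinearEquiv

variable [IsLocalRing A]

theorem length_tensor {S : Type*} [AddCommGroup S] [Module R S] [Module A S]
    [IsScalarTower A R S] [Module.Flat A S] {Q : Type*} [AddCommGroup Q] [Module A Q]
    (hQ : IsFiniteLength A Q) : Module.length R (S ⊗[A] Q) =
      Module.length A Q * Module.length R (S ⊗[A] (A ⧸ maximalIdeal A)) := by
  induction hQ with
  | of_subsingleton => simp only [Module.length_eq_zero, zero_mul]
  | @of_simple_quotient Q _ _ L hL _ ih =>
    obtain ⟨I, hI, ⟨e⟩⟩ := isSimpleModule_iff_quot_maximal.1 hL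
    obtain rfl := eq_maximalIdeal hI
    rw [Module.length_eq_add_of_exact L.subtype L.mkQ L.injective_subtype L.mkQ_surjective
        (LinearMap.exact_subtype_mkQ L),
      Module.length_eq_add_of_exact (AlgebraTensorModule.lTensor R S L.subtype)
        (AlgebraTensorModule.lTensor R S L.mkQ)
        (Module.Flat.lTensor_preserves_injective_linearMap _ L.injective_subtype)
        (LinearMap.lTensor_surjective _ L.mkQ_surjective)
        (lTensor_exact S (LinearMap.exact_subtype_mkQ L) L.mkQ_surjective),
      ih, Module.length_eq_one A (Q ⧸ L), add_mul, one_mul,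
      (AlgebraTensorModule.congr (LinearEquiv.refl R S) e).length_eq]

end Fibre

section BaseChange

variable {A : Type u} {R : Type v} {B T : Type*} [CommRing A] [CommRing R] [CommRing B] [CommRing T]
  [Algebra A R] [Algebra A B] [Algebra R T] [Algebra B T] [Algebra A T] [IsScalarTower A B T]
  [IsScalarTower A R T] [SMulCommClass B R T] {M : Type*} [AddCommGroup M] [Module A M] [Module B M]
  [IsScalarTower A B M]

/-- The base change isomorphism `(T ⊗ M) ⊗ (R/J ⊗ Q) ≅ T/JT ⊗ (M ⊗ Q)`. -/
def tensorBaseChangeEquiv (J : Ideal R) (M Q : Type*) [AddCommGroup M] [Module A M] [Module B M]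
    [IsScalarTower A B M] [AddCommGroup Q] [Module A Q] :
    (T ⊗[B] M) ⊗[R] ((R ⧸ J) ⊗[A] Q) ≃ₗ[T] (T ⧸ J.map (algebraMap R T)) ⊗[B] (M ⊗[A] Q) :=
  have : SMulCommClass R B T := .symm B R T
  AlgebraTensorModule.tensorTensorTensorComm A B R T T M (R ⧸ J) Q ≪≫ₗ
    AlgebraTensorModule.congr
      (Algebra.TensorProduct.quotIdealMapEquivTensorQuot T J).symm.toLinearEquiv
      (LinearEquiv.refl B _)

theorem tensorBaseChangeEquiv_tmul {J : Ideal R} {Q : Type*} [AddCommGroup Q] [Module A Q] (b : T)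
    (n : M) (r : R) (z : Q) :
    tensorBaseChangeEquiv (A := A) J M Q ((b ⊗ₜ[B] n) ⊗ₜ[R] (Ideal.Quotient.mk J r ⊗ₜ[A] z)) =
      Ideal.Quotient.mk _ (b * algebraMap R T r) ⊗ₜ[B] (n ⊗ₜ[A] z) := by
  have h : (Algebra.TensorProduct.quotIdealMapEquivTensorQuot T J).symm
      (b ⊗ₜ Ideal.Quotient.mk J r) = Ideal.Quotient.mk _ (b * algebraMap R T r) := by
    rw [mul_comm, ← Algebra.smul_def]
    rfl
  exact congrArg (· ⊗ₜ (n ⊗ₜ z)) h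

theorem smul_tmul_mk_tmul_eq_zero_iff {J : Ideal R} [Module.Flat B (T ⧸ J.map (algebraMap R T))]
    {Q : Type*} [AddCommGroup Q] [Module A Q] {n : M} {z : Q} {b : T} {r : R} :
    (b • ((1 : T) ⊗ₜ[B] n)) ⊗ₜ[R] (Ideal.Quotient.mk J r ⊗ₜ[A] z) = 0 ↔
      b * algebraMap R T r ∈ (Ideal.torsionOf B (M ⊗[A] Q) (n ⊗ₜ z)).map (algebraMap B T) ⊔
        J.map (algebraMap R T) := by
  rw [TensorProduct.smul_tmul', smul_eq_mul, mul_one,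
    ← (tensorBaseChangeEquiv J M Q).map_eq_zero_iff, tensorBaseChangeEquiv_tmul,
    mk_tmul_eq_zero_iff]

variable [IsLocalRing A] [IsNoetherianRing A]

theorem map_impurityIdeal_sup_le [IsNoetherianRing B] {n : M} {J : Ideal R}
    [Module.Flat A (R ⧸ J)] [Module.Flat B (T ⧸ J.map (algebraMap R T))]
    (hJ : IsSocleGenerator R ((1 : R ⧸ J) ⊗ₜ[A] (1 : A ⧸ maximalIdeal A))) :
    (impurityIdeal A B n).map (algebraMap B T) ⊔ J.map (algebraMap R T) ≤
      impurityIdeal R T ((1 : T) ⊗ₜ[B] n) := by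
  obtain ⟨Q, _, _, u, hQ, hu, hI⟩ := exists_torsionOf_eq_impurityIdeal (A := A) (B := B) n
  obtain ⟨_, _⟩ := isFiniteLength_iff_isNoetherian_isArtinian.1 hQ
  have : Module.Finite R ((R ⧸ J) ⊗[A] Q) := .trans (R ⧸ J) _
  intro b hb
  refine torsionOf_tmul_le_impurityIdeal _ (hu.tmul hQ hJ).1 ?_
  rwa [Ideal.mem_torsionOf_iff, TensorProduct.smul_tmul', ← map_one (Ideal.Quotient.mk J),
    smul_tmul_mk_tmul_eq_zero_iff, map_one, mul_one, hI]

theorem exists_mul_mem_of_mem_impurityIdeal [IsLocalRing R] [IsNoetherianRing R]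
    [IsNoetherianRing T] [IsLocalHom (algebraMap A R)] {n : M} {J : ℕ → Ideal R} {c : ℕ → R}
    [∀ t, Module.Flat A (R ⧸ J t)] [∀ t, Module.Flat B (T ⧸ (J t).map (algebraMap R T))]
    (hJ : ∀ t, J t ≤ maximalIdeal R ^ t)
    (hfin : ∀ t, IsFiniteLength R ((R ⧸ J t) ⊗[A] (A ⧸ maximalIdeal A)))
    (hc : ∀ t, IsSocleGenerator R
      (Ideal.Quotient.mk (J t) (c t) ⊗ₜ[A] (1 : A ⧸ maximalIdeal A)))
    {b : T} (hb : b ∈ impurityIdeal R T ((1 : T) ⊗ₜ[B] n)) :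
    ∃ t, b * algebraMap R T (c t) ∈
      (impurityIdeal A B n).map (algebraMap B T) ⊔ (J t).map (algebraMap R T) := by
  obtain ⟨Q', _, _, u', hQ', hu', hbu'⟩ :=
    exists_of_not_isPureMap (not_isPureMap_of_mem_impurityIdeal hb)
  obtain ⟨t, ht⟩ := exists_pow_maximalIdeal_le_annihilator hQ'
  obtain ⟨Q, _, _, u, hQ, hu, hann⟩ := IsSocleGenerator.exists_annihilator_eq
    (J := maximalIdeal A ^ (t + 1))
    (ne_top_of_le_ne_top (maximalIdeal.isMaximal A).ne_top (Ideal.pow_le_self t.succ_ne_zero))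
    (isFiniteLength_of_pow_maximalIdeal_le_annihilator (Ideal.annihilator_quotient).ge)
  obtain ⟨_, _⟩ := isFiniteLength_iff_isNoetherian_isArtinian.1 hQ
  have hQR : IsFiniteLength R ((R ⧸ J t) ⊗[A] Q) := by
    rw [← Module.length_ne_top_iff, length_tensor hQ]
    exact WithTop.mul_ne_top (Module.length_ne_top_iff.2 hQ) (Module.length_ne_top_iff.2 (hfin t))
  have hle : Module.annihilator R ((R ⧸ J t) ⊗[A] Q) ≤ Module.annihilator R Q' := by
    refine (annihilator_quotient_tensor_le Q).trans ((sup_le ?_ (hJ t)).trans ht)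
    rw [hann, Ideal.map_pow]
    exact (Ideal.pow_right_mono (map_maximalIdeal_le (algebraMap A R)) _
      ).trans (Ideal.pow_le_pow_right t.le_succ)
  obtain ⟨i, hi⟩ := (hu.tmul hQ (hc t)).exists_map_eq hu' hQR hQ' hle
  refine ⟨t, ?_⟩
  have htor := sup_le_sup_right (Ideal.map_mono (f := algebraMap B T)
    (torsionOf_tmul_le_impurityIdeal (A := A) (B := B) n hu.1)) ((J t).map (algebraMap R T))
  refine htor (smul_tmul_mk_tmul_eq_zero_iff.1 ?_)
  rw [← hi, ← LinearMap.lTensor_tmul, hbu', map_zero]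

end BaseChange

section FibreSequence

open RingTheory.Sequence

variable {A R : Type*} [CommRing A] [CommRing R] [Algebra A R] [IsLocalRing A] [IsLocalRing R]

theorem ofList_map_pow_le {l : List R} (hl : ∀ x ∈ l, x ∈ maximalIdeal R) (k : ℕ) :
    Ideal.ofList (l.map (· ^ k)) ≤ maximalIdeal R ^ k := by
  refine Ideal.span_le.2 fun y hy => ?_
  obtain ⟨x, hx, rfl⟩ := List.mem_map.1 hy
  exact Ideal.pow_mem_pow (hl x hx) k

theorem length_quotient_tensor_residue {J : Ideal R}
    (hJ : (maximalIdeal A).map (algebraMap A R) ⊔ J = maximalIdeal R) :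
    Module.length R ((R ⧸ J) ⊗[A] (A ⧸ maximalIdeal A)) = 1 := by
  rw [(quotTensorQuotEquiv J (maximalIdeal A)).length_eq, hJ, Module.length_eq_one_iff]
  exact isSimpleModule_iff_quot_maximal.2 ⟨_, inferInstance, ⟨LinearEquiv.refl R _⟩⟩

theorem isSocleGenerator_one_tmul_one {J : Ideal R}
    (hJ : (maximalIdeal A).map (algebraMap A R) ⊔ J = maximalIdeal R) :
    IsSocleGenerator R ((1 : R ⧸ J) ⊗ₜ[A] (1 : A ⧸ maximalIdeal A)) := by
  have := Module.length_eq_one_iff.1 (length_quotient_tensor_residue hJ)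
  have := IsSimpleModule.nontrivial R ((R ⧸ J) ⊗[A] (A ⧸ maximalIdeal A))
  exact ⟨one_ne_zero, fun z hz => IsSimpleModule.toSpanSingleton_surjective R hz _⟩

variable [IsNoetherianRing R] {l : List R}

theorem length_quotient_ofList_map_pow_tensor_residue (hl : ∀ x ∈ l, x ∈ maximalIdeal R)
    (hreg : IsWeaklyRegular (R ⊗[A] (A ⧸ maximalIdeal A)) l)
    (hmax : (maximalIdeal A).map (algebraMap A R) ⊔ Ideal.ofList l = maximalIdeal R) (t : ℕ) :
    Module.length R ((R ⧸ Ideal.ofList (l.map (· ^ (t + 1)))) ⊗[A] (A ⧸ maximalIdeal A)) =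
      ((t + 1) ^ l.length : ℕ) := by
  rw [← (quotSMulTopTensorEquivQuotTensor _ (A ⧸ maximalIdeal A)).length_eq,
    length_quotient_ofList_map_pow hl hreg,
    (quotSMulTopTensorEquivQuotTensor _ (A ⧸ maximalIdeal A)).length_eq,
    length_quotient_tensor_residue hmax, mul_one]

theorem isSocleGenerator_mk_prod_pow_tmul_one (hl : ∀ x ∈ l, x ∈ maximalIdeal R)
    (hreg : IsWeaklyRegular (R ⊗[A] (A ⧸ maximalIdeal A)) l)
    (hmax : (maximalIdeal A).map (algebraMap A R) ⊔ Ideal.ofList l = maximalIdeal R) (t : ℕ) :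
    IsSocleGenerator R (Ideal.Quotient.mk (Ideal.ofList (l.map (· ^ (t + 1)))) (l.prod ^ t)
      ⊗ₜ[A] (1 : A ⧸ maximalIdeal A)) := by
  have h₀ : IsSocleGenerator R (Submodule.Quotient.mk ((1 : R) ⊗ₜ[A] (1 : A ⧸ maximalIdeal A)) :
      (R ⊗[A] (A ⧸ maximalIdeal A)) ⧸ (Ideal.ofList l • ⊤ : Submodule R _)) := by
    convert (isSocleGenerator_one_tmul_one hmax).map_equiv
      (quotSMulTopTensorEquivQuotTensor _ (A ⧸ maximalIdeal A)).symm
    rw [LinearEquiv.eq_symm_apply, quotSMulTopTensorEquivQuotTensor_mk, map_one]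
  convert (h₀.quotient_ofList_map_pow hl hreg t).map_equiv
    (quotSMulTopTensorEquivQuotTensor _ (A ⧸ maximalIdeal A))
  rw [TensorProduct.smul_tmul', smul_eq_mul, mul_one, quotSMulTopTensorEquivQuotTensor_mk]

variable [IsNoetherianRing A] [IsLocalHom (algebraMap A R)] [Module.Flat A R]

theorem flat_quotient_ofList_map_pow (hl : ∀ x ∈ l, x ∈ maximalIdeal R)
    (hreg : IsWeaklyRegular (R ⊗[A] (A ⧸ maximalIdeal A)) l) (t : ℕ) :
    Module.Flat A (R ⧸ Ideal.ofList (l.map (· ^ (t + 1)))) := by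
  have h := flat_quotient_of_isWeaklyRegular (isWeaklyRegular_map_pow hl hreg t)
  rwa [smul_eq_mul, Ideal.mul_top] at h

theorem mem_sup_ofList_of_mul_prod_pow_mem (hl : ∀ x ∈ l, x ∈ maximalIdeal R)
    (hreg : IsWeaklyRegular (R ⊗[A] (A ⧸ maximalIdeal A)) l)
    (hmax : (maximalIdeal A).map (algebraMap A R) ⊔ Ideal.ofList l = maximalIdeal R) {I : Ideal A}
    (hI : IsFiniteLength A (A ⧸ I)) {s t : ℕ} {b : R}
    (hb : b * l.prod ^ t ∈ I.map (algebraMap A R) ⊔ Ideal.ofList (l.map (· ^ (s + t + 1)))) :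
    b ∈ I.map (algebraMap A R) ⊔ Ideal.ofList (l.map (· ^ (s + 1))) := by
  let J (k : ℕ) : Ideal R := Ideal.ofList (l.map (· ^ (k + 1)))
  have hflat (k : ℕ) : Module.Flat A (R ⧸ J k) := flat_quotient_ofList_map_pow hl hreg k
  have hJ : J s ≤
      LinearMap.ker ((J (s + t)).mkQ ∘ₗ LinearMap.toSpanSingleton R R (l.prod ^ t)) := by
    refine Ideal.span_le.2 fun y hy => (Submodule.Quotient.mk_eq_zero _).2 ?_
    obtain ⟨x, hx, rfl⟩ := List.mem_map.1 hy
    refine Ideal.mem_of_dvd _ (mul_dvd_mul_left _ (pow_dvd_pow_of_dvd (List.dvd_prod hx) t)) ?_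
    change x ^ (s + 1) * x ^ t ∈ J (s + t)
    rw [← pow_add, add_right_comm]
    exact Ideal.subset_span (List.mem_map_of_mem hx)
  let f : (R ⧸ J s) →ₗ[R] R ⧸ J (s + t) := (J s).liftQ _ hJ
  have hf_mk (r : R) : f (Ideal.Quotient.mk _ r) = Ideal.Quotient.mk _ (r * l.prod ^ t) := rfl
  have hf : Function.Injective ((f.restrictScalars A).rTensor (A ⧸ maximalIdeal A)) := by
    refine (isSocleGenerator_mk_prod_pow_tmul_one hl hreg hmax s).injective_of_map_ne_zero
      (AlgebraTensorModule.rTensor A _ f) ?_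
    rw [AlgebraTensorModule.rTensor_tmul, hf_mk, ← pow_add]
    exact (isSocleGenerator_mk_prod_pow_tmul_one hl hreg hmax (s + t)).1
  rw [← torsionOf_quotient_one I, ← mk_tmul_eq_zero_iff] at hb ⊢
  exact (injective_iff_map_eq_zero _).1 (rTensor_injective_of_isFiniteLength _ hf hI) _ hb

end FibreSequence

section RegularLocalRing

open RingTheory.Sequence

variable {R : Type*} [CommRing R]

theorem exists_ringKrullDim_quotient_eq [FiniteRingKrullDim R] :
    ∃ P : PrimeSpectrum R, ringKrullDim (R ⧸ P.asIdeal) = ringKrullDim R := by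
  let s := LTSeries.longestOf (PrimeSpectrum R)
  refine ⟨s.head, le_antisymm (ringKrullDim_quotient_le _) ?_⟩
  let t : LTSeries (PrimeSpectrum.zeroLocus (R := R) s.head.asIdeal) :=
    ⟨s.length, fun i => ⟨s i, s.monotone (Fin.zero_le i)⟩, s.step⟩
  rw [ringKrullDim_quotient, ringKrullDim, Order.krullDim_eq_length_of_finiteDimensionalOrder]
  exact Order.LTSeries.length_le_krullDim t

variable [IsLocalRing R] [IsNoetherianRing R]

theorem ringKrullDim_le_quotient_span_singleton_add_one {y : R} (hy : y ∈ maximalIdeal R) :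
    ringKrullDim R ≤ ringKrullDim (R ⧸ Ideal.span {y}) + 1 := by
  rw [← maximalIdeal_height_eq_ringKrullDim]
  exact Ideal.height_le_ringKrullDim_quotient_add_one hy

/- If `Q` is a prime with `dim R ⧸ Q = dim R`, then `R ⧸ (y)` and its quotient by the image of `Q`
have the same dimension, so that `Q ⊆ (y)`; as `y ∉ Q`, this gives `Q = y Q`, whence `Q = 0`. -/
theorem isDomain_of_isDomain_quotient_span_singleton {y : R} (hy : y ∈ maximalIdeal R)
    [IsDomain (R ⧸ Ideal.span {y})]
    (hdim : ringKrullDim (R ⧸ Ideal.span {y}) < ringKrullDim R) : IsDomain R := by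
  obtain ⟨⟨Q, hQ⟩, hQdim⟩ := exists_ringKrullDim_quotient_eq (R := R)
  have hyQ : y ∉ Q := fun h => hdim.not_ge <| hQdim ▸
    ringKrullDim_le_of_surjective _
      (Ideal.Quotient.factor_surjective ((Ideal.span_singleton_le_iff_mem Q).2 h))
  have : IsLocalRing (R ⧸ Q) := .of_surjective' _ Ideal.Quotient.mk_surjective
  have hyQ' : Ideal.Quotient.mk Q y ∈ maximalIdeal (R ⧸ Q) := by
    rw [← map_maximalIdeal_of_surjective _ Ideal.Quotient.mk_surjective]
    exact Ideal.mem_map_of_mem _ hy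
  have hle : Q ≤ Ideal.span {y} := by
    intro a ha
    by_contra hay
    let f := (Ideal.Quotient.mk (Ideal.span {Ideal.Quotient.mk Q y})).comp (Ideal.Quotient.mk Q)
    have hf : ∀ b ∈ Ideal.span {y}, f b = 0 := fun b hb => by
      obtain ⟨r, rfl⟩ := Ideal.mem_span_singleton'.1 hb
      refine Ideal.Quotient.eq_zero_iff_mem.2 ?_
      rw [map_mul]
      exact Ideal.mul_mem_left _ _ (Ideal.mem_span_singleton_self _)
    have hfa : f a = 0 := by
      simp only [f, RingHom.comp_apply, Ideal.Quotient.eq_zero_iff_mem.2 ha, map_zero]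
    have hf_surj : Function.Surjective f :=
      Ideal.Quotient.mk_surjective.comp Ideal.Quotient.mk_surjective
    refine hdim.not_ge ?_
    calc ringKrullDim R = ringKrullDim (R ⧸ Q) := hQdim.symm
      _ ≤ ringKrullDim ((R ⧸ Q) ⧸ Ideal.span {Ideal.Quotient.mk Q y}) + 1 :=
        ringKrullDim_le_quotient_span_singleton_add_one hyQ'
      _ ≤ ringKrullDim (R ⧸ Ideal.span {y}) :=
        ringKrullDim_succ_le_of_surjective (Ideal.Quotient.lift _ f hf)
          (Ideal.Quotient.lift_surjective_of_surjective _ _ hf_surj)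
          (mem_nonZeroDivisors_of_ne_zero (mt Ideal.Quotient.eq_zero_iff_mem.1 hay)) hfa
  have hbot : Q = ⊥ := by
    refine Submodule.eq_bot_of_le_smul_of_le_jacobson_bot (maximalIdeal R) Q
      Q.fg_of_isNoetherianRing (fun a ha => ?_) (maximalIdeal_le_jacobson _)
    obtain ⟨r, rfl⟩ := Ideal.mem_span_singleton'.1 (hle ha)
    rw [mul_comm]
    exact Submodule.smul_mem_smul hy ((hQ.mem_or_mem ha).resolve_right hyQ)
  subst hbot
  exact IsDomain.of_bot_isPrime R

theorem ringKrullDim_le_length {l : List R} (hl : Ideal.ofList l = maximalIdeal R) :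
    ringKrullDim R ≤ l.length := by
  classical
  refine (ringKrullDim_le_spanFinrank_maximalIdeal R).trans ?_
  have h := Submodule.spanFinrank_span_le_ncard_of_finite (R := R) (l.toFinset.finite_toSet)
  rw [Set.ncard_coe_finset, List.coe_toFinset] at h
  rw [← hl]
  exact_mod_cast h.trans l.toFinset_card_le

theorem isDomain_and_isWeaklyRegular_of_ofList_eq_maximalIdeal {l : List R}
    (hl : Ideal.ofList l = maximalIdeal R) (hdim : l.length ≤ ringKrullDim R) :
    IsDomain R ∧ IsWeaklyRegular R l := by
  induction hd : l.length generalizing R l with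
  | zero =>
    obtain rfl := List.length_eq_zero_iff.1 hd
    rw [Ideal.ofList_nil] at hl
    exact ⟨(isField_iff_maximalIdeal_eq.2 hl.symm).isDomain, .nil R R⟩
  | succ d ih =>
    obtain ⟨y, l, rfl⟩ := List.exists_of_length_succ l hd
    have hy : y ∈ maximalIdeal R := hl ▸ Ideal.subset_span (List.mem_cons_self)
    let π := Ideal.Quotient.mk (Ideal.span {y})
    have : Nontrivial (R ⧸ Ideal.span {y}) := Ideal.Quotient.nontrivial_iff.2 fun h =>
      (mem_maximalIdeal y).1 hy (Ideal.span_singleton_eq_top.1 h)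
    have : IsLocalRing (R ⧸ Ideal.span {y}) := .of_surjective' π Ideal.Quotient.mk_surjective
    have hl' : Ideal.ofList (l.map π) = maximalIdeal (R ⧸ Ideal.span {y}) := by
      rw [← map_maximalIdeal_of_surjective π Ideal.Quotient.mk_surjective, ← hl,
        ← Ideal.map_ofList, Ideal.ofList_cons, Ideal.map_sup, Ideal.map_quotient_self, bot_sup_eq]
    rw [List.length_cons, Nat.cast_succ] at hdim
    have hle : (l.map π).length ≤ ringKrullDim (R ⧸ Ideal.span {y}) := by
      rw [List.length_map]
      exact ENat.WithBot.add_le_add_one_right_iff.1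
        (hdim.trans (ringKrullDim_le_quotient_span_singleton_add_one hy))
    have hlt : ringKrullDim (R ⧸ Ideal.span {y}) < ringKrullDim R :=
      (ringKrullDim_le_length hl').trans_lt (lt_of_lt_of_le
        (by rw [List.length_map]; exact_mod_cast l.length.lt_succ_self) hdim)
    obtain ⟨_, hreg⟩ := ih hl' hle (by simpa using hd)
    have := isDomain_of_isDomain_quotient_span_singleton hy hlt
    have hy₀ : y ≠ 0 := by
      rintro rfl
      rw [Ideal.span_singleton_eq_bot.2 rfl,
        ringKrullDim_eq_of_ringEquiv (RingEquiv.quotientBot R)] at hlt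
      exact hlt.false
    refine ⟨this, (isWeaklyRegular_cons_iff R y l).2 ⟨(IsRegular.of_ne_zero hy₀).left, ?_⟩⟩
    refine (LinearEquiv.isWeaklyRegular_congr (Submodule.quotEquivOfEq _ _ ?_) l).1
      ((isWeaklyRegular_map_algebraMap_iff (R ⧸ Ideal.span {y}) (R ⧸ Ideal.span {y}) l).1 hreg)
    rw [← Submodule.ideal_span_singleton_smul, smul_eq_mul, Ideal.mul_top]

omit [IsNoetherianRing R] in
theorem sup_ofList_eq_maximalIdeal {I : Ideal R} [IsLocalRing (R ⧸ I)] {l : List R}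
    (hl : Ideal.ofList (l.map (Ideal.Quotient.mk I)) = maximalIdeal (R ⧸ I)) :
    I ⊔ Ideal.ofList l = maximalIdeal R := by
  have hloc : IsLocalHom (Ideal.Quotient.mk I) := .of_surjective _ Ideal.Quotient.mk_surjective
  have hcomap : (maximalIdeal (R ⧸ I)).comap (Ideal.Quotient.mk I) = maximalIdeal R :=
    ((local_hom_TFAE (Ideal.Quotient.mk I)).out 0 4).1 hloc
  rw [← hcomap, ← hl, ← Ideal.map_ofList,
    Ideal.comap_map_of_surjective _ Ideal.Quotient.mk_surjective, ← RingHom.ker_eq_comap_bot,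
    Ideal.mk_ker, sup_comm]

theorem exists_list_ofList_eq_maximalIdeal (S : Type*) [CommRing S] [IsRegularLocalRing S] :
    ∃ l : List S, ringKrullDim S = l.length ∧ Ideal.ofList l = maximalIdeal S := by
  obtain ⟨s, hs, hspan⟩ :=
    Submodule.FG.exists_span_finset_card_eq_spanFinrank (maximalIdeal S).fg_of_isNoetherianRing
  refine ⟨s.toList, ?_, ?_⟩
  · rw [Finset.length_toList, hs, IsRegularLocalRing.spanFinrank_maximalIdeal]
  · rw [← hspan, Ideal.ofList]
    simp only [Finset.mem_toList, Finset.setOfPred_mem]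

end RegularLocalRing

section NormalDomain

variable {R : Type*} [CommRing R] [IsDomain R] [IsNoetherianRing R] [IsIntegrallyClosed R]

/- Otherwise `c / b` multiplies `q` into itself, hence is integral over `R`. -/
theorem exists_mul_eq_mul_notMem {b c : R} (hb : b ≠ 0) (hc : ¬ b ∣ c) {q : Ideal R}
    (hq : ∀ r, r ∈ q ↔ b ∣ r * c) : ∃ t ∈ q, ∃ u ∉ q, t * c = b * u := by
  by_contra! hcon
  have hbK : algebraMap R (FractionRing R) b ≠ 0 := by simpa using hb
  let z : FractionRing R := algebraMap R _ c / algebraMap R _ b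
  let N : Submodule R (FractionRing R) := Submodule.map (Algebra.linearMap R _) q
  have hN : N ≠ ⊥ := fun h => hbK <| by
    have hbN : algebraMap R (FractionRing R) b ∈ N := ⟨b, (hq b).2 (dvd_mul_right b c), rfl⟩
    rwa [h, Submodule.mem_bot] at hbN
  have hzN : ∀ n ∈ N, z * n ∈ N := by
    rintro _ ⟨s, hs, rfl⟩
    obtain ⟨u, hu⟩ := (hq s).1 hs
    refine ⟨u, by_contra fun h => hcon s hs u h hu, ?_⟩
    rw [Algebra.linearMap_apply, Algebra.linearMap_apply, div_mul_eq_mul_div, eq_div_iff hbK,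
      ← map_mul, ← map_mul, mul_comm u, ← hu, mul_comm]
  obtain ⟨y, hy⟩ := IsIntegrallyClosed.isIntegral_iff.1
    (isIntegral_of_smul_mem_submodule N hN (Submodule.FG.map _ q.fg_of_isNoetherianRing) z hzN)
  refine hc ⟨y, IsFractionRing.injective R (FractionRing R) ?_⟩
  rw [map_mul, hy, mul_div_cancel₀ _ hbK]

theorem height_eq_one_of_forall_mem_iff_dvd_mul {b c : R} (hb : b ≠ 0) {q : Ideal R}
    [hqp : q.IsPrime] (hq : ∀ r, r ∈ q ↔ b ∣ r * c) : q.height = 1 := by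
  have hbq : b ∈ q := (hq b).2 (dvd_mul_right b c)
  have hc : ¬ b ∣ c := fun h => hqp.one_notMem ((hq 1).2 (by rwa [one_mul]))
  obtain ⟨t, ht, u, hu, htu⟩ := exists_mul_eq_mul_notMem hb hc hq
  have hmin : q ∈ (Ideal.span {t}).minimalPrimes := by
    refine ⟨⟨hqp, (Ideal.span_singleton_le_iff_mem q).2 ht⟩, fun P ⟨hP, htP⟩ hPq s hs => ?_⟩
    obtain ⟨s', hs'⟩ := (hq s).1 hs
    have hsu : s * u = s' * t := mul_left_cancel₀ hb (by linear_combination t * hs' - s * htu)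
    have hsuP : s * u ∈ P :=
      hsu ▸ P.mul_mem_left _ ((Ideal.span_singleton_le_iff_mem P).1 htP)
    exact (hP.mem_or_mem hsuP).resolve_right fun h => hu (hPq h)
  refine le_antisymm (Ideal.height_le_one_of_isPrincipal_of_mem_minimalPrimes _ q hmin) ?_
  rw [Order.one_le_iff_ne_zero, Ne, Ideal.height_eq_zero_iff_eq_bot]
  exact Submodule.ne_bot_iff q |>.2 ⟨b, hbq, hb⟩

theorem exists_height_eq_one_and_dvd_mul {a b : R} (hb : b ≠ 0) (hba : ¬ b ∣ a) :
    ∃ Q : HeightOnePrime R, ∀ s, b ∣ s * a → s ∈ Q.1.asIdeal := by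
  have hdvd : ∀ x r : R, r ∈ (⊥ : Submodule R (R ⧸ Ideal.span {b})).colon
      {Ideal.Quotient.mk (Ideal.span {b}) x} ↔ b ∣ r * x := fun x r => by
    rw [Submodule.mem_colon_singleton, Submodule.mem_bot, Algebra.smul_def,
      Ideal.Quotient.algebraMap_eq, ← map_mul, Ideal.Quotient.eq_zero_iff_mem,
      Ideal.mem_span_singleton]
  have ha : Ideal.Quotient.mk (Ideal.span {b}) a ≠ 0 := by
    rwa [Ne, Ideal.Quotient.eq_zero_iff_mem, Ideal.mem_span_singleton]
  obtain ⟨q, hqass, hq⟩ := exists_le_isAssociatedPrime_of_isNoetherianRing (R := R) _ ha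
  obtain ⟨hqp, c, hqc⟩ := isAssociatedPrime_iff.1 hqass
  obtain ⟨c, rfl⟩ := Ideal.Quotient.mk_surjective c
  have hht : q.height = 1 :=
    height_eq_one_of_forall_mem_iff_dvd_mul hb fun r => by rw [hqc, hdvd c]
  exact ⟨⟨⟨q, hqp⟩, hht⟩, fun s hs => hq ((hdvd a s).2 hs)⟩

namespace HeightOnePrime

theorem exists_mul_eq_algebraMap (Q : HeightOnePrime R) {z : FractionRing R}
    (hz : Q.valuation z ≤ 1) :
    ∃ s ∉ Q.1.asIdeal, ∃ r : R, algebraMap R (FractionRing R) s * z = algebraMap R _ r := by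
  obtain ⟨y, rfl⟩ := IsDiscreteValuationRing.exists_lift_of_le_one hz
  obtain ⟨⟨r, s⟩, hs⟩ := IsLocalization.surj Q.1.asIdeal.primeCompl y
  refine ⟨s, s.2, r, ?_⟩
  have := congrArg (algebraMap Q.localRing (FractionRing R)) hs
  rwa [map_mul, ← IsScalarTower.algebraMap_apply, ← IsScalarTower.algebraMap_apply,
    mul_comm] at this

theorem mem_one_of_valuation_le_one {z : FractionRing R}
    (hz : ∀ Q : HeightOnePrime R, Q.valuation z ≤ 1) :
    z ∈ (1 : Submodule R (FractionRing R)) := by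
  rw [Submodule.mem_one]
  obtain ⟨a, b, hb, rfl⟩ := IsFractionRing.div_surjective (A := R) z
  have hb₀ : b ≠ 0 := nonZeroDivisors.ne_zero hb
  have hbK : algebraMap R (FractionRing R) b ≠ 0 := by simpa using hb₀
  have hba : b ∣ a := by
    by_contra hba
    obtain ⟨Q, hQ⟩ := exists_height_eq_one_and_dvd_mul hb₀ hba
    obtain ⟨s, hs, r, hr⟩ := Q.exists_mul_eq_algebraMap (hz Q)
    refine hs (hQ s ⟨r, IsFractionRing.injective R (FractionRing R) ?_⟩)
    rw [map_mul, map_mul, ← hr]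
    field_simp
  obtain ⟨y, rfl⟩ := hba
  exact ⟨y, by rw [map_mul, mul_div_cancel_left₀ _ hbK]⟩

variable (Q : HeightOnePrime R)

theorem valuation_irreducible_pow {ϖ : Q.localRing} (hϖ : Irreducible ϖ) (n : ℕ) :
    Q.valuation (algebraMap Q.localRing (FractionRing R) (ϖ ^ n)) = WithZero.exp (-n : ℤ) := by
  have h := Ring.ordFrac_irreducible (K := FractionRing R) hϖ
  rw [Ring.ordFrac_eq_valuation_inv, inv_eq_iff_eq_inv] at h
  rw [map_pow, map_pow, valuation, h, ← WithZero.exp_neg, ← WithZero.exp_nsmul]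
  simp

theorem valuation_mul_le_one_iff_forall_map {J : Ideal R} {z : FractionRing R} :
    (∀ y ∈ J.map (algebraMap R Q.localRing),
      Q.valuation (z * algebraMap Q.localRing (FractionRing R) y) ≤ 1) ↔
    ∀ j ∈ J, Q.valuation (z * algebraMap R (FractionRing R) j) ≤ 1 := by
  refine ⟨fun h j hj => ?_, fun h y hy => ?_⟩
  · rw [IsScalarTower.algebraMap_apply R Q.localRing (FractionRing R)]
    exact h _ (Ideal.mem_map_of_mem _ hj)
  induction hy using Submodule.span_induction with
  | mem y hy =>
    obtain ⟨j, hj, rfl⟩ := hy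
    rw [← IsScalarTower.algebraMap_apply]
    exact h j hj
  | zero => simp
  | add x y _ _ hx hy =>
    rw [map_add, mul_add]
    exact Valuation.map_add_le _ hx hy
  | smul a y _ hy =>
    rw [smul_eq_mul, map_mul (algebraMap Q.localRing (FractionRing R)), mul_left_comm, map_mul]
    exact mul_le_one' (IsDedekindDomain.HeightOneSpectrum.valuation_le_one _ _) hy

theorem valuation_le_exp_iff {J : Ideal R} {n : ℕ}
    (hJ : J.map (algebraMap R Q.localRing) = maximalIdeal Q.localRing ^ n) (z : FractionRing R) :
    Q.valuation z ≤ WithZero.exp (n : ℤ) ↔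
      ∀ j ∈ J, Q.valuation (z * algebraMap R (FractionRing R) j) ≤ 1 := by
  obtain ⟨ϖ, hϖ⟩ := IsDiscreteValuationRing.exists_irreducible Q.localRing
  have hn : Q.valuation z ≤ WithZero.exp (n : ℤ) ↔
      Q.valuation (z * algebraMap Q.localRing (FractionRing R) (ϖ ^ n)) ≤ 1 := by
    rw [map_mul, Q.valuation_irreducible_pow hϖ, WithZero.exp_neg,
      ← div_eq_mul_inv, div_le_one₀ WithZero.exp_pos]
  rw [hn, ← valuation_mul_le_one_iff_forall_map, hJ, hϖ.maximalIdeal_eq, Ideal.span_singleton_pow]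
  refine ⟨fun h y hy => ?_, fun h => h _ (Ideal.mem_span_singleton_self _)⟩
  obtain ⟨c, rfl⟩ := Ideal.mem_span_singleton.1 hy
  rw [map_mul (algebraMap Q.localRing (FractionRing R)), ← mul_assoc, map_mul]
  exact mul_le_one' h (IsDedekindDomain.HeightOneSpectrum.valuation_le_one _ _)

end HeightOnePrime

theorem WeilDivisor.sections_eq_one_div_coeSubmodule {E : WeilDivisor R} (hE : 0 ≤ E)
    {J : Ideal R} (hJ : ∀ Q : HeightOnePrime R,
      J.map (algebraMap R Q.localRing) = maximalIdeal Q.localRing ^ (E Q).toNat) :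
    E.sections = 1 / IsLocalization.coeSubmodule (FractionRing R) J := by
  have h : ∀ z Q, Q.valuation z ≤ WithZero.exp (E Q) ↔
      ∀ j ∈ J, Q.valuation (z * algebraMap R (FractionRing R) j) ≤ 1 := fun z Q => by
    rw [← Q.valuation_le_exp_iff (hJ Q), Int.toNat_of_nonneg (hE Q)]
  ext z
  rw [Submodule.mem_div_iff_forall_mul_mem]
  constructor
  · rintro hz _ ⟨j, hj, rfl⟩
    exact HeightOnePrime.mem_one_of_valuation_le_one fun Q => (h z Q).1 (hz Q) j hj
  · refine fun hz Q => (h z Q).2 fun j hj => ?_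
    obtain ⟨r, hr⟩ := Submodule.mem_one.1 (hz _ ⟨j, hj, rfl⟩)
    rw [← Algebra.linearMap_apply, ← hr]
    exact Q.valuation_algebraMap_le_one r

end NormalDomain

section DivisorIdeal

theorem map_eq_top_of_not_le_under {A R : Type*} [CommRing A] [CommRing R] [Algebra A R]
    {q : Ideal R} [q.IsPrime] {I : Ideal A} (hI : ¬ I ≤ q.under A) :
    I.map (algebraMap A (Localization.AtPrime q)) = ⊤ := by
  obtain ⟨a, ha, haq⟩ := SetLike.not_le_iff_exists.1 hI
  refine Ideal.eq_top_of_isUnit_mem _ (Ideal.mem_map_of_mem _ ha) ?_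
  rw [IsScalarTower.algebraMap_apply A R (Localization.AtPrime q)]
  exact IsLocalization.map_units (Localization.AtPrime q) (⟨_, haq⟩ : q.primeCompl)

theorem HeightOnePrime.eq_of_le {A : Type*} [CommRing A] {P P' : HeightOnePrime A}
    (h : P.1.asIdeal ≤ P'.1.asIdeal) : P = P' := by
  have : P.1.asIdeal.FiniteHeight := by simp [Ideal.finiteHeight_iff, P.2]
  exact Subtype.ext (PrimeSpectrum.ext (Ideal.eq_of_le_of_height_le _ h (by rw [P.2, P'.2])))

theorem eq_maximalIdeal_pow_length_quotient {S : Type*} [CommRing S] [IsDomain S]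
    [IsDiscreteValuationRing S] {I : Ideal S} (hI : I ≠ ⊥) :
    I = maximalIdeal S ^ (Module.length S (S ⧸ I)).toNat := by
  obtain ⟨n, rfl⟩ : ∃ n : ℕ, I = maximalIdeal S ^ n := exists_maximalIdeal_pow_eq_of_principal
    S (IsPrincipalIdealRing.principal _) I hI
  rw [IsDiscreteValuationRing.length_quotient_pow_maximalIdeal, ENat.toNat_natCast]

namespace WeilDivisor

/-- The ideal `∏ P ^ n_P` attached to an effective divisor `D = ∑ n_P P`. Its localization at every
height one prime is that of the ideal sheaf of `D`, so that `A(D)` consists of the fractions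
multiplying it into `A`. -/
def ideal {A : Type*} [CommRing A] (D : WeilDivisor A) : Ideal A :=
  ∏ P ∈ D.support, P.1.asIdeal ^ (D P).toNat

theorem ideal_ne_bot {A : Type*} [CommRing A] [IsDomain A] (D : WeilDivisor A) :
    D.ideal ≠ ⊥ := by
  rw [ideal, Ne, ← Ideal.zero_eq_bot, Finset.prod_eq_zero_iff]
  rintro ⟨P, -, hP⟩
  exact Ideal.ne_bot_of_height_eq_one P.2 (eq_zero_of_pow_eq_zero hP)

section Map

variable {A S : Type*} [CommRing A] [CommRing S] (D : WeilDivisor A) (φ : A →+* S)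

theorem map_ideal : D.ideal.map φ = ∏ P ∈ D.support, P.1.asIdeal.map φ ^ (D P).toNat := by
  rw [ideal, ← Ideal.mapHom_apply, map_prod]
  simp only [Ideal.mapHom_apply, Ideal.map_pow]

theorem map_ideal_eq_top (h : ∀ P : HeightOnePrime A, P.1.asIdeal.map φ = ⊤) :
    D.ideal.map φ = ⊤ := by
  rw [D.map_ideal, ← Ideal.one_eq_top]
  exact Finset.prod_eq_one fun P _ => by rw [h P, ← Ideal.one_eq_top, one_pow]

theorem map_ideal_eq_pow (P : HeightOnePrime A)
    (h : ∀ P' : HeightOnePrime A, P' ≠ P → P'.1.asIdeal.map φ = ⊤) :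
    D.ideal.map φ = P.1.asIdeal.map φ ^ (D P).toNat := by
  rw [D.map_ideal]
  refine Finset.prod_eq_single P (fun P' _ hP' => ?_) fun hP => ?_
  · rw [h P' hP', ← Ideal.one_eq_top, one_pow]
  · rw [Finsupp.notMem_support_iff.1 hP, Int.toNat_zero, pow_zero]

theorem map_ideal_localRing (P : HeightOnePrime A) :
    D.ideal.map (algebraMap A P.localRing) = maximalIdeal P.localRing ^ (D P).toNat := by
  rw [D.map_ideal_eq_pow _ P fun P' hP' => map_eq_top_of_not_le_under fun h =>
    hP' (HeightOnePrime.eq_of_le h), Localization.AtPrime.map_eq_maximalIdeal]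

end Map

theorem map_ideal_localRing_pullback {A : Type u} [CommRing A] [IsDomain A] [IsNoetherianRing A]
    {R : Type v} [CommRing R] [IsDomain R] [IsNoetherianRing R] [IsIntegrallyClosed R]
    [Algebra A R] [Module.Flat A R] (D : WeilDivisor A) (hD : 0 ≤ D) (Q : HeightOnePrime R) :
    (D.ideal.map (algebraMap A R)).map (algebraMap R Q.localRing) =
      maximalIdeal Q.localRing ^ (D.pullback R Q).toNat := by
  rw [Ideal.map_map, ← IsScalarTower.algebraMap_eq]
  change _ = _ ^ (D.pullbackCoeff R Q).toNat
  rw [pullbackCoeff]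
  split_ifs with h
  · let P : HeightOnePrime A := ⟨⟨Q.1.asIdeal.under A, inferInstance⟩, h⟩
    have hinj : Function.Injective (algebraMap A Q.localRing) := by
      rw [IsScalarTower.algebraMap_eq A R]
      exact (IsLocalization.injective Q.localRing Q.1.asIdeal.primeCompl_le_nonZeroDivisors).comp
        (FaithfulSMul.algebraMap_injective A R)
    have hP : P.1.asIdeal.map (algebraMap A Q.localRing) ≠ ⊥ := by
      rw [Ne, Ideal.map_eq_bot_iff_of_injective hinj]
      exact Ideal.ne_bot_of_height_eq_one h
    rw [D.map_ideal_eq_pow _ P fun P' hP' => map_eq_top_of_not_le_under fun h =>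
      hP' (HeightOnePrime.eq_of_le h), Int.toNat_mul (hD P) (Int.natCast_nonneg _),
      Int.toNat_natCast, mul_comm, pow_mul]
    exact congrArg (· ^ (D P).toNat) (eq_maximalIdeal_pow_length_quotient hP)
  · rw [Int.toNat_zero, pow_zero, Ideal.one_eq_top]
    refine D.map_ideal_eq_top _ fun P => map_eq_top_of_not_le_under fun hle => h ?_
    have hgd := Ideal.height_eq_height_add_of_liesOver_of_hasGoingDown
      (Q.1.asIdeal.under A) Q.1.asIdeal
    exact le_antisymm ((le_self_add.trans hgd.ge).trans Q.2.le)
      (P.2.ge.trans (Ideal.height_mono hle))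

end WeilDivisor

end DivisorIdeal

section FlatBaseChange

variable {A R : Type*} [CommRing A] [CommRing R] [Algebra A R]

theorem map_colon [Module.Flat A R] {I J : Ideal A} (hI : I.FG) :
    (J.colon (I : Set A)).map (algebraMap A R) =
      (J.map (algebraMap A R)).colon (I.map (algebraMap A R) : Set R) := by
  classical
  obtain ⟨t, rfl⟩ := hI
  rw [Ideal.map_span, Ideal.colon_span, Ideal.colon_span]
  let w : t → A ⧸ J := fun i => Ideal.Quotient.mk J i
  have hw : Ideal.torsionOf A _ w = J.colon (t : Set A) := by
    ext a
    rw [Ideal.mem_torsionOf_iff, Submodule.mem_colon, funext_iff, Subtype.forall]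
    exact forall₂_congr fun i _ => Ideal.Quotient.eq_zero_iff_mem (a := a * i)
  ext s
  have hs : s ⊗ₜ[A] w = 0 ↔ s ∈ (J.colon (t : Set A)).map (algebraMap A R) := by
    rw [tmul_eq_zero_iff_mem_torsionOf_smul_top, hw, Ideal.smul_top_eq_map,
      Submodule.restrictScalars_mem]
  have hmk (r : R) : r ⊗ₜ[A] (1 : A ⧸ J) = 0 ↔ r ∈ J.map (algebraMap A R) := by
    rw [tmul_eq_zero_iff_mem_torsionOf_smul_top, torsionOf_quotient_one, Ideal.smul_top_eq_map,
      Submodule.restrictScalars_mem]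
  rw [← hs, ← (TensorProduct.piRight A R R fun _ : t => A ⧸ J).map_eq_zero_iff, funext_iff,
    Submodule.mem_colon, Set.forall_mem_image, Subtype.forall]
  refine forall₂_congr fun i _ => ?_
  rw [← hmk (s • algebraMap A R i), smul_eq_mul, mul_comm, ← Algebra.smul_def,
    TensorProduct.smul_tmul, Algebra.smul_def, mul_one]
  rfl

section OneDiv

variable {K : Type*} [Field K] [Algebra A K]

theorem mem_one_div_coeSubmodule_iff {I : Ideal A} {z : K} :
    z ∈ 1 / IsLocalization.coeSubmodule K I ↔
      ∀ i ∈ I, ∃ c, algebraMap A K c = z * algebraMap A K i := by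
  rw [Submodule.mem_div_iff_forall_mul_mem]
  exact ⟨fun h i hi => Submodule.mem_one.1 (h _ ⟨i, hi, rfl⟩),
    fun h _ ⟨i, hi, e⟩ => e ▸ Submodule.mem_one.2 (h i hi)⟩

theorem mem_one_div_coeSubmodule_iff_exists_colon [IsFractionRing A K] {I : Ideal A}
    {d : A} (hdI : d ∈ I) (hd : d ≠ 0) {z : K} :
    z ∈ 1 / IsLocalization.coeSubmodule K I ↔
      ∃ a ∈ (Ideal.span {d}).colon (I : Set A), algebraMap A K a = z * algebraMap A K d := by
  have hdK : algebraMap A K d ≠ 0 := by simpa using hd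
  rw [mem_one_div_coeSubmodule_iff]
  constructor
  · intro hz
    obtain ⟨a, ha⟩ := hz d hdI
    refine ⟨a, Submodule.mem_colon.2 fun i hi => ?_, ha⟩
    obtain ⟨c, hc⟩ := hz i hi
    refine Ideal.mem_span_singleton.2 ⟨c, IsFractionRing.injective A K ?_⟩
    rw [smul_eq_mul, map_mul, map_mul, ha, hc]
    ring
  · rintro ⟨a, ha, haz⟩ i hi
    obtain ⟨c, hc⟩ := Ideal.mem_span_singleton.1 (Submodule.mem_colon.1 ha i hi)
    refine ⟨c, mul_left_cancel₀ hdK ?_⟩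
    rw [← map_mul, ← hc, smul_eq_mul, map_mul, haz]
    ring

end OneDiv

variable (K L : Type*) [Field K] [Field L] [Algebra A K] [Algebra R L] [Algebra A L]
  [IsScalarTower A R L] [Algebra K L] [IsScalarTower A K L]

/-- The map `R ⊗ M → L`, `r ⊗ z ↦ r z`, for an `A`-submodule `M` of the fraction field `K` of `A`,
where `L` is the fraction field of `R`. -/
def fractionBaseChange (M : Submodule A K) : R ⊗[A] M →ₗ[R] L :=
  LinearMap.liftBaseChange R ((IsScalarTower.toAlgHom A K L).toLinearMap ∘ₗ M.subtype)

theorem fractionBaseChange_tmul (M : Submodule A K) (r : R) (m : M) :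
    fractionBaseChange K L M (r ⊗ₜ m) = r • algebraMap K L m := by
  simp [fractionBaseChange]

variable [IsFractionRing A K] [IsFractionRing R L] [Module.Flat A R]

theorem fractionBaseChange_injective (M : Submodule A K) :
    Function.Injective (fractionBaseChange (R := R) K L M) := by
  let f : R ⊗[A] K →ₐ[R] L :=
    Algebra.TensorProduct.lift (Algebra.ofId R L) (IsScalarTower.toAlgHom A K L)
      fun _ _ => Commute.all _ _
  have hf : Function.Injective f := by
    refine IsLocalization.injective_of_map_algebraMap_zero
      (M := Algebra.algebraMapSubmonoid R (nonZeroDivisors A)) (R ⊗[A] K) (f : _ →+* L)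
      fun r hr => ?_
    have hr₀ : algebraMap R L r = 0 := by rw [← f.commutes]; exact hr
    rw [(map_eq_zero_iff _ (IsFractionRing.injective R L)).1 hr₀, map_zero]
  have hM : fractionBaseChange K L M = f.toLinearMap ∘ₗ M.subtype.baseChange R := by
    ext m
    simp [fractionBaseChange, f]
  rw [hM]
  exact hf.comp (Module.Flat.lTensor_preserves_injective_linearMap _ M.subtype_injective)

theorem mem_one_div_coeSubmodule_map_iff_exists_map_colon [IsDomain A] [IsDomain R] {I : Ideal A}
    (hI : I.FG) {d : A} (hdI : d ∈ I) (hd : d ≠ 0) {z : L} :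
    z ∈ 1 / IsLocalization.coeSubmodule L (I.map (algebraMap A R)) ↔
      ∃ s ∈ ((Ideal.span {d}).colon (I : Set A)).map (algebraMap A R),
        algebraMap R L s = z * algebraMap A L d := by
  have hdR : algebraMap A R d ≠ 0 :=
    (map_ne_zero_iff _ (FaithfulSMul.algebraMap_injective A R)).2 hd
  rw [mem_one_div_coeSubmodule_iff_exists_colon (Ideal.mem_map_of_mem _ hdI) hdR,
    map_colon hI, Ideal.map_span, Set.image_singleton, ← IsScalarTower.algebraMap_apply A R L]

theorem range_fractionBaseChange_one_div [IsDomain A] [IsDomain R] [IsNoetherianRing A]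
    {I : Ideal A} (hI : I ≠ ⊥) :
    LinearMap.range (fractionBaseChange K L (1 / IsLocalization.coeSubmodule K I)) =
      1 / IsLocalization.coeSubmodule L (I.map (algebraMap A R)) := by
  obtain ⟨d, hdI, hd⟩ := Submodule.exists_mem_ne_zero_of_ne_bot hI
  let C := (Ideal.span {d}).colon (I : Set A)
  have hdL : algebraMap A L d ≠ 0 := by
    rw [IsScalarTower.algebraMap_apply A R L]
    simpa using hd
  have hmem (z : L) := mem_one_div_coeSubmodule_map_iff_exists_map_colon (R := R) L
    I.fg_of_isNoetherianRing hdI hd (z := z)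
  refine le_antisymm ?_ fun z hz => ?_
  · rintro _ ⟨x, rfl⟩
    induction x using TensorProduct.induction_on with
    | zero => rw [map_zero]; exact zero_mem _
    | add x y hx hy => rw [map_add]; exact add_mem hx hy
    | tmul r m =>
      obtain ⟨a, ha, ham⟩ := (mem_one_div_coeSubmodule_iff_exists_colon hdI hd).1 m.2
      rw [fractionBaseChange_tmul]
      refine Submodule.smul_mem _ r ((hmem _).2 ⟨_, Ideal.mem_map_of_mem _ ha, ?_⟩)
      rw [← IsScalarTower.algebraMap_apply, IsScalarTower.algebraMap_apply A K L, ham, map_mul,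
        ← IsScalarTower.algebraMap_apply]
  · obtain ⟨s, hs, hsz⟩ := (hmem z).1 hz
    let T : Ideal R := (LinearMap.range
      (fractionBaseChange K L (1 / IsLocalization.coeSubmodule K I))).comap
      (LinearMap.mulRight R (algebraMap A L d)⁻¹ ∘ₗ Algebra.linearMap R L)
    have hCT : C.map (algebraMap A R) ≤ T := by
      refine Ideal.map_le_iff_le_comap.2 fun a ha => ?_
      have haK : algebraMap A K a / algebraMap A K d ∈
          1 / IsLocalization.coeSubmodule K I :=
        (mem_one_div_coeSubmodule_iff_exists_colon hdI hd).2
          ⟨a, ha, (div_mul_cancel₀ _ (by simpa using hd)).symm⟩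
      refine ⟨1 ⊗ₜ ⟨_, haK⟩, ?_⟩
      rw [fractionBaseChange_tmul, one_smul, map_div₀, ← IsScalarTower.algebraMap_apply,
        ← IsScalarTower.algebraMap_apply, div_eq_mul_inv, IsScalarTower.algebraMap_apply A R L a]
      rfl
    have hsT : algebraMap R L s * (algebraMap A L d)⁻¹ ∈
        LinearMap.range (fractionBaseChange K L (1 / IsLocalization.coeSubmodule K I)) := hCT hs
    rwa [hsz, mul_inv_cancel_right₀ hdL] at hsT

end FlatBaseChange

theorem WeilDivisor.exists_baseChange_sections_equiv {A : Type u} {R : Type v} [CommRing A]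
    [CommRing R] [IsDomain A] [IsDomain R] [IsNoetherianRing A] [IsNoetherianRing R]
    [IsIntegrallyClosed A] [IsIntegrallyClosed R] [Algebra A R] [Module.Flat A R]
    {D : WeilDivisor A} (hD : 0 ≤ D) :
    ∃ φ : R ⊗[A] D.sections ≃ₗ[R] (D.pullback R).sections,
      φ (1 ⊗ₜ ⟨algebraMap A (FractionRing A) 1, algebraMap_mem_sections hD 1⟩) =
        ⟨algebraMap R (FractionRing R) 1,
          algebraMap_mem_sections (pullback_nonneg R hD) 1⟩ := by
  have : FaithfulSMul A (FractionRing R) := FaithfulSMul.trans A R (FractionRing R)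
  let := FractionRing.liftAlgebra A (FractionRing R)
  let ψ := fractionBaseChange (R := R) (FractionRing A) (FractionRing R) D.sections
  have hψ : LinearMap.range ψ = (D.pullback R).sections := by
    rw [sections_eq_one_div_coeSubmodule (pullback_nonneg R hD) (D.map_ideal_localRing_pullback hD),
      ← range_fractionBaseChange_one_div (FractionRing A) (FractionRing R) D.ideal_ne_bot,
      ← sections_eq_one_div_coeSubmodule hD D.map_ideal_localRing]
  refine ⟨(LinearEquiv.ofInjective ψ (fractionBaseChange_injective _ _ _)).trans
    (LinearEquiv.ofEq _ _ hψ), Subtype.ext ?_⟩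
  change ψ (1 ⊗ₜ _) = _
  rw [fractionBaseChange_tmul, one_smul]
  simp only [map_one]

theorem impurityIdeal_map_equiv {A : Type u} {B : Type*} [CommRing A] [CommRing B] [Algebra A B]
    {M M' : Type*} [AddCommGroup M] [Module A M] [Module B M] [IsScalarTower A B M]
    [AddCommGroup M'] [Module A M'] [Module B M'] [IsScalarTower A B M'] (φ : M ≃ₗ[B] M') (n : M) :
    impurityIdeal A B (φ n) = impurityIdeal A B n := by
  have h (b : B) : IsPureMap (LinearMap.toSpanSingleton A M' (b • φ n)) ↔
      IsPureMap (LinearMap.toSpanSingleton A M (b • n)) := by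
    have hcomp : LinearMap.toSpanSingleton A M' (b • φ n) =
        (φ.restrictScalars A).toLinearMap ∘ₗ LinearMap.toSpanSingleton A M (b • n) := by
      ext
      simp
    refine forall₃_congr fun Q _ _ => ?_
    rw [hcomp, LinearMap.rTensor_comp, LinearMap.coe_comp]
    exact ((φ.restrictScalars A).rTensor Q).injective.of_comp_iff _
  simp only [impurityIdeal, h]

/-- The ring `F^e_* R`: a copy of `R`, an algebra over `R` through the `e`-th iterate of Frobenius.
It acts on `F^e_* M` as `R` acts on `M`. -/
def FrobeniusRing (R : Type*) (_p _e : ℕ) : Type _ := R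

namespace FrobeniusRing

variable (A R : Type*) (p e : ℕ) [CommRing A] [CommRing R] [Algebra A R]

instance : CommRing (FrobeniusRing R p e) := inferInstanceAs (CommRing R)

instance [IsNoetherianRing R] : IsNoetherianRing (FrobeniusRing R p e) :=
  inferInstanceAs (IsNoetherianRing R)

instance [ExpChar R p] : Algebra A (FrobeniusRing R p e) :=
  RingHom.toAlgebra (S := R) ((iterateFrobenius R p e).comp (algebraMap A R))

instance : Algebra (FrobeniusRing A p e) (FrobeniusRing R p e) := inferInstanceAs (Algebra A R)

instance [ExpChar R p] : IsScalarTower A R (FrobeniusRing R p e) :=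
  .of_algebraMap_eq' (R := A) (S := R) (A := FrobeniusRing R p e) rfl

instance [ExpChar A p] [ExpChar R p] :
    IsScalarTower A (FrobeniusRing A p e) (FrobeniusRing R p e) :=
  .of_algebraMap_eq (R := A) (S := FrobeniusRing A p e) (A := FrobeniusRing R p e) fun a =>
    ((algebraMap A R).map_iterateFrobenius p a e).symm

instance (M : Type*) [AddCommGroup M] [Module R M] :
    Module (FrobeniusRing R p e) (FrobeniusPushforward R p e M) := inferInstanceAs (Module R M)

instance [ExpChar R p] (M : Type*) [AddCommGroup M] [Module R M] :
    IsScalarTower R (FrobeniusRing R p e) (FrobeniusPushforward R p e M) :=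
  ⟨fun _ _ _ => mul_smul (α := R) (β := M) _ _ _⟩

end FrobeniusRing

section Divisor

variable {A : Type u} [CommRing A] [IsDomain A] [IsNoetherianRing A] [IsIntegrallyClosed A]
  (D : WeilDivisor A) (p e : ℕ) (hD : 0 ≤ D)

/-- The section `F^e_* 1` of `F^e_* A(D)`. -/
def WeilDivisor.frobeniusOne (D : WeilDivisor A) (p e : ℕ) (hD : 0 ≤ D) :
    FrobeniusPushforward A p e D.sections :=
  FrobeniusPushforward.of A p e D.sections
    ⟨algebraMap A (FractionRing A) 1, algebraMap_mem_sections hD 1⟩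

theorem WeilDivisor.degeneracyIdeal_eq [ExpChar A p] :
    D.degeneracyIdeal p e hD = impurityIdeal A (FrobeniusRing A p e) (D.frobeniusOne p e hD) := by
  refine congrArg Ideal.span (Set.ext fun a => not_congr ?_)
  have h : D.frobeniusMap p e hD a = LinearMap.toSpanSingleton A _
      ((show FrobeniusRing A p e from a) • D.frobeniusOne p e hD) := by
    refine congrArg (LinearMap.toSpanSingleton A (FrobeniusPushforward A p e D.sections)) ?_
    refine Subtype.ext ?_
    change algebraMap A (FractionRing A) a = a • algebraMap A (FractionRing A) 1
    rw [Algebra.smul_def, map_one, mul_one]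
  rw [h]

theorem WeilDivisor.degeneracyIdeal_pullback_eq {R : Type v} [CommRing R] [IsDomain R]
    [IsNoetherianRing R] [IsIntegrallyClosed R] [Algebra A R] [Module.Flat A R] [ExpChar R p] :
    (D.pullback R).degeneracyIdeal p e (pullback_nonneg R hD) =
      impurityIdeal R (FrobeniusRing R p e)
        ((1 : FrobeniusRing R p e) ⊗ₜ[FrobeniusRing A p e] D.frobeniusOne p e hD) := by
  obtain ⟨φ, hφ⟩ := exists_baseChange_sections_equiv (R := R) hD
  let ψ : FrobeniusRing R p e ⊗[FrobeniusRing A p e] FrobeniusPushforward A p e D.sections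
      ≃ₗ[FrobeniusRing R p e] FrobeniusPushforward R p e (D.pullback R).sections := φ
  have hψ : ψ (1 ⊗ₜ D.frobeniusOne p e hD) =
    (D.pullback R).frobeniusOne p e (pullback_nonneg R hD) := hφ
  rw [degeneracyIdeal_eq, ← hψ]
  exact impurityIdeal_map_equiv (A := R) ψ _

end Divisor

section FrobeniusBaseChange

open RingTheory.Sequence

theorem map_iterateFrobenius_ofList {R : Type*} [CommRing R] (p e : ℕ) [ExpChar R p]
    (l : List R) : (Ideal.ofList l).map (iterateFrobenius R p e) =
      Ideal.ofList (l.map (· ^ p ^ e)) :=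
  Ideal.map_ofList _ _

theorem map_iterateFrobenius_ofList_map_pow {R : Type*} [CommRing R] {p e s : ℕ} [ExpChar R p]
    (hs : p ^ e = s + 1) (l : List R) (t : ℕ) :
    (Ideal.ofList (l.map (· ^ (t + 1)))).map (iterateFrobenius R p e) =
      Ideal.ofList (l.map (· ^ (s + t * (s + 1) + 1))) := by
  rw [map_iterateFrobenius_ofList, List.map_map, hs]
  congr 2
  ext x
  rw [Function.comp_apply, ← pow_mul]
  ring_nf

variable {A : Type u} {R : Type v} [CommRing A] [CommRing R] [Algebra A R]
  [IsLocalRing A] [IsNoetherianRing A] [IsLocalRing R] [IsNoetherianRing R]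
  [IsLocalHom (algebraMap A R)] [Module.Flat A R] (p e : ℕ) [ExpChar A p] [ExpChar R p]

omit [IsLocalRing R] [IsNoetherianRing R] [IsLocalHom (algebraMap A R)] [Module.Flat A R]
  [ExpChar R p] in
theorem isFiniteLength_quotient_of_map_iterateFrobenius_le {I : Ideal A}
    (h : (maximalIdeal A).map (iterateFrobenius A p e) ≤ I) : IsFiniteLength A (A ⧸ I) := by
  have hrad : maximalIdeal A ≤ I.radical := fun a ha => ⟨p ^ e, h (Ideal.mem_map_of_mem _ ha)⟩
  obtain ⟨j, hj⟩ :=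
    Ideal.exists_pow_le_of_le_radical_of_fg hrad (maximalIdeal A).fg_of_isNoetherianRing
  exact isFiniteLength_of_pow_maximalIdeal_le_annihilator
    (hj.trans Ideal.annihilator_quotient.ge)

theorem impurityIdeal_frobenius_baseChange {M : Type*} [AddCommGroup M] [Module A M]
    (n : FrobeniusPushforward A p e M) {l : List R} (hl : ∀ x ∈ l, x ∈ maximalIdeal R)
    (hreg : IsWeaklyRegular (R ⊗[A] (A ⧸ maximalIdeal A)) l)
    (hmax : (maximalIdeal A).map (algebraMap A R) ⊔ Ideal.ofList l = maximalIdeal R) :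
    impurityIdeal R (FrobeniusRing R p e) ((1 : FrobeniusRing R p e) ⊗ₜ[FrobeniusRing A p e] n) =
      (impurityIdeal A (FrobeniusRing A p e) n).map
        (algebraMap (FrobeniusRing A p e) (FrobeniusRing R p e)) ⊔
      (Ideal.ofList l).map (algebraMap R (FrobeniusRing R p e)) := by
  obtain ⟨s, hs⟩ : ∃ s, p ^ e = s + 1 := Nat.exists_eq_add_one.2 (pow_pos (expChar_pos A p) e)
  let I : Ideal A := impurityIdeal A (FrobeniusRing A p e) n
  let J (t : ℕ) : Ideal R := Ideal.ofList (l.map (· ^ (t + 1)))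
  have hJ₀ : J 0 = Ideal.ofList l := by simp [J]
  have hJmap (t : ℕ) : (J t).map (iterateFrobenius R p e) = J (s + t * (s + 1)) :=
    map_iterateFrobenius_ofList_map_pow hs l t
  have hI : IsFiniteLength A (A ⧸ I) :=
    isFiniteLength_quotient_of_map_iterateFrobenius_le p e
      (map_maximalIdeal_le_impurityIdeal (B := FrobeniusRing A p e) n)
  have hflat (t : ℕ) : Module.Flat A (R ⧸ J t) := flat_quotient_ofList_map_pow hl hreg t
  have hflat' (t : ℕ) : Module.Flat (FrobeniusRing A p e)
      (FrobeniusRing R p e ⧸ (J t).map (algebraMap R (FrobeniusRing R p e))) := by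
    have h := hflat (s + t * (s + 1))
    rw [← hJmap] at h
    exact h
  rw [← hJ₀]
  refine le_antisymm (fun (b : R) hb => ?_)
    (map_impurityIdeal_sup_le (isSocleGenerator_one_tmul_one (hJ₀.symm ▸ hmax)))
  obtain ⟨t, ht⟩ := exists_mul_mem_of_mem_impurityIdeal
    (fun t => (ofList_map_pow_le hl _).trans (Ideal.pow_le_pow_right t.le_succ))
    (fun t => Module.length_ne_top_iff.1
      (length_quotient_ofList_map_pow_tensor_residue hl hreg hmax t ▸ ENat.natCast_ne_top _))
    (isSocleGenerator_mk_prod_pow_tmul_one hl hreg hmax) hb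
  change b * iterateFrobenius R p e (l.prod ^ t) ∈
    I.map (algebraMap A R) ⊔ (J t).map (iterateFrobenius R p e) at ht
  change b ∈ I.map (algebraMap A R) ⊔ (J 0).map (iterateFrobenius R p e)
  rw [hJmap, iterateFrobenius_def, hs, ← pow_mul] at ht
  rw [hJmap, zero_mul]
  exact mem_sup_ofList_of_mul_prod_pow_mem hl hreg hmax hI ht

end FrobeniusBaseChange

section Main

open RingTheory.Sequence

theorem ofList_ofFn {R : Type*} [CommRing R] {n : ℕ} (f : Fin n → R) :
    Ideal.ofList (List.ofFn f) = Ideal.span (Set.range f) := by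
  simp only [Ideal.ofList, List.mem_ofFn]
  rfl

variable {A : Type u} {R : Type v} [CommRing A] [CommRing R] [Algebra A R]
  [IsLocalRing A] [IsNoetherianRing R]

section Fibre

variable [IsLocalRing (R ⧸ (maximalIdeal A).map (algebraMap A R))]

theorem isWeaklyRegular_tensor_residue {l : List R}
    (hdim : ringKrullDim (R ⧸ (maximalIdeal A).map (algebraMap A R)) = l.length)
    (hl : Ideal.ofList (l.map (Ideal.Quotient.mk ((maximalIdeal A).map (algebraMap A R)))) =
      maximalIdeal (R ⧸ (maximalIdeal A).map (algebraMap A R))) :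
    IsWeaklyRegular (R ⊗[A] (A ⧸ maximalIdeal A)) l := by
  have h := (isDomain_and_isWeaklyRegular_of_ofList_eq_maximalIdeal hl
    (by rw [List.length_map, hdim])).2
  rw [← Ideal.Quotient.algebraMap_eq, isWeaklyRegular_map_algebraMap_iff] at h
  exact (((maximalIdeal A).qoutMapEquivTensorQout R).isWeaklyRegular_congr l).1 h

theorem ringKrullDim_eq_add_quotient_map_maximalIdeal [IsNoetherianRing A] [IsLocalRing R]
    [IsLocalHom (algebraMap A R)] [Module.Flat A R] :
    ringKrullDim R =
      ringKrullDim A + ringKrullDim (R ⧸ (maximalIdeal A).map (algebraMap A R)) := by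
  rw [← maximalIdeal_height_eq_ringKrullDim,
    Ideal.height_eq_height_add_of_liesOver_of_hasGoingDown (maximalIdeal A) (maximalIdeal R),
    ← maximalIdeal_height_eq_ringKrullDim, ← maximalIdeal_height_eq_ringKrullDim, WithBot.coe_add,
    map_maximalIdeal_of_surjective _ Ideal.Quotient.mk_surjective]

end Fibre

variable [IsNoetherianRing A] [IsLocalRing R] [IsLocalHom (algebraMap A R)] [Module.Flat A R]

theorem length_quotient_map_sup_ofList_map_pow {l : List R} (hl : ∀ x ∈ l, x ∈ maximalIdeal R)
    (hreg : IsWeaklyRegular (R ⊗[A] (A ⧸ maximalIdeal A)) l)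
    (hmax : (maximalIdeal A).map (algebraMap A R) ⊔ Ideal.ofList l = maximalIdeal R) {I : Ideal A}
    (hI : IsFiniteLength A (A ⧸ I)) (t : ℕ) :
    Module.length R (R ⧸ I.map (algebraMap A R) ⊔ Ideal.ofList (l.map (· ^ (t + 1)))) =
      ((t + 1) ^ l.length : ℕ) * Module.length A (A ⧸ I) := by
  have := flat_quotient_ofList_map_pow hl hreg t
  rw [← (quotTensorQuotEquiv _ I).length_eq, length_tensor hI,
    length_quotient_ofList_map_pow_tensor_residue hl hreg hmax, mul_comm]

variable [IsDomain A] [IsIntegrallyClosed A] (D : WeilDivisor A) (hD : 0 ≤ D) (p e : ℕ)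
  [ExpChar A p]

omit [IsNoetherianRing R] in
theorem WeilDivisor.isFiniteLength_quotient_degeneracyIdeal :
    IsFiniteLength A (A ⧸ D.degeneracyIdeal p e hD) :=
  isFiniteLength_quotient_of_map_iterateFrobenius_le p e <| by
    rw [degeneracyIdeal_eq]
    exact map_maximalIdeal_le_impurityIdeal (B := FrobeniusRing A p e) (D.frobeniusOne p e hD)

variable [IsDomain R] [IsIntegrallyClosed R] [ExpChar R p]
  [IsLocalRing (R ⧸ (maximalIdeal A).map (algebraMap A R))]

theorem WeilDivisor.degeneracyIdeal_pullback_eq_sup {l : List R}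
    (hdim : ringKrullDim (R ⧸ (maximalIdeal A).map (algebraMap A R)) = l.length)
    (hl : Ideal.ofList (l.map (Ideal.Quotient.mk ((maximalIdeal A).map (algebraMap A R)))) =
      maximalIdeal (R ⧸ (maximalIdeal A).map (algebraMap A R))) :
    (D.pullback R).degeneracyIdeal p e (pullback_nonneg R hD) =
      (D.degeneracyIdeal p e hD).map (algebraMap A R) ⊔ Ideal.ofList (l.map (· ^ p ^ e)) := by
  have hmax := sup_ofList_eq_maximalIdeal hl
  have hlm : ∀ x ∈ l, x ∈ maximalIdeal R := fun x hx =>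
    hmax ▸ Ideal.mem_sup_right (Ideal.subset_span hx)
  rw [← map_iterateFrobenius_ofList, degeneracyIdeal_pullback_eq, D.degeneracyIdeal_eq]
  exact impurityIdeal_frobenius_baseChange p e (D.frobeniusOne p e hD) hlm
    (isWeaklyRegular_tensor_residue hdim hl) hmax

theorem WeilDivisor.length_quotient_degeneracyIdeal_pullback {l : List R}
    (hdim : ringKrullDim (R ⧸ (maximalIdeal A).map (algebraMap A R)) = l.length)
    (hl : Ideal.ofList (l.map (Ideal.Quotient.mk ((maximalIdeal A).map (algebraMap A R)))) =
      maximalIdeal (R ⧸ (maximalIdeal A).map (algebraMap A R))) :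
    Module.length R (R ⧸ (D.pullback R).degeneracyIdeal p e (pullback_nonneg R hD)) =
      (p ^ (e * l.length) : ℕ) * Module.length A (A ⧸ D.degeneracyIdeal p e hD) := by
  obtain ⟨s, hs⟩ : ∃ s, p ^ e = s + 1 := Nat.exists_eq_add_one.2 (pow_pos (expChar_pos A p) e)
  have hmax := sup_ofList_eq_maximalIdeal hl
  have hlm : ∀ x ∈ l, x ∈ maximalIdeal R := fun x hx =>
    hmax ▸ Ideal.mem_sup_right (Ideal.subset_span hx)
  rw [D.degeneracyIdeal_pullback_eq_sup hD p e hdim hl, hs,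
    length_quotient_map_sup_ofList_map_pow hlm (isWeaklyRegular_tensor_residue hdim hl) hmax
      (D.isFiniteLength_quotient_degeneracyIdeal hD p e), pow_mul, hs]

end Main

end

theorem lemma3p4 {A R : Type*} [CommRing A] [CommRing R]
    [IsNoetherianRing A] [IsLocalRing A] [IsDomain A] [IsIntegrallyClosed A]
    [IsNoetherianRing R] [IsLocalRing R] [IsDomain R] [IsIntegrallyClosed R]
    (p : ℕ) [Fact p.Prime] [CharP A p] [CharP R p]
    [Algebra A R] [Module.Flat A R] [IsLocalHom (algebraMap A R)]
    [IsRegularLocalRing (R ⧸ (maximalIdeal A).map (algebraMap A R))]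
    (D : WeilDivisor A) (hD : 0 ≤ D) (e : ℕ) (he : 0 < e) :
    (∃ n : ℕ, ringKrullDim R = ringKrullDim A + n ∧
      Module.length A (A ⧸ D.degeneracyIdeal p e hD) ≠ ⊤ ∧
      Module.length R (R ⧸ (D.pullback R).degeneracyIdeal p e (WeilDivisor.pullback_nonneg R hD)) =
        (p ^ (e * n) : ℕ) * Module.length A (A ⧸ D.degeneracyIdeal p e hD)) ∧
    ∀ (δ : ℕ) (x : Fin δ → R),
      ringKrullDim (R ⧸ (maximalIdeal A).map (algebraMap A R)) = δ →
      Ideal.span (Set.range fun i =>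
          Ideal.Quotient.mk ((maximalIdeal A).map (algebraMap A R)) (x i)) =
        maximalIdeal (R ⧸ (maximalIdeal A).map (algebraMap A R)) →
      (D.pullback R).degeneracyIdeal p e (WeilDivisor.pullback_nonneg R hD) =
        (D.degeneracyIdeal p e hD).map (algebraMap A R) ⊔
          Ideal.span (Set.range fun i => x i ^ p ^ e) := by
  refine ⟨?_, fun δ x hdim hx => ?_⟩
  · obtain ⟨l', hdim, hl'⟩ :=
      exists_list_ofList_eq_maximalIdeal (R ⧸ (maximalIdeal A).map (algebraMap A R))
    obtain ⟨l, rfl⟩ := List.map_surjective_iff.2 Ideal.Quotient.mk_surjective l'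
    rw [List.length_map] at hdim
    exact ⟨l.length, hdim ▸ ringKrullDim_eq_add_quotient_map_maximalIdeal,
      Module.length_ne_top_iff.2 (D.isFiniteLength_quotient_degeneracyIdeal hD p e),
      D.length_quotient_degeneracyIdeal_pullback hD p e hdim hl'⟩
  · have hl : Ideal.ofList ((List.ofFn x).map (Ideal.Quotient.mk _)) =
        maximalIdeal (R ⧸ (maximalIdeal A).map (algebraMap A R)) := by
      rw [List.map_ofFn, ofList_ofFn]
      exact hx
    rw [D.degeneracyIdeal_pullback_eq_sup hD p e (by rwa [List.length_ofFn]) hl, List.map_ofFn,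
      ofList_ofFn]
    rfl
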